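/- **Setting.** Let $K\subset\mathbb R^n$ be compact, let $f,g$ be smooth $\mathbb R^n$-valued maps on an open neighbourhood $U$ of $K$, and let $M$ be a smooth Riemannian metric on $U$, i.e. $M(x)$ is a symmetric positive definite matrix depending smoothly on $x\in U$. Put $V(x,\delta)=\sqrt{\delta'M(x)\delta}$. Let $S=\{x: c(x)=0\}$, $c(x)=z'x-b$, be a flat switching surface, and consider the hybrid system $$\dot x=f(x)\ \ (x\notin S),\qquad x^+=g(x)\ \ (x\in S).$$ A solution is a sequence of continuous phases $\varphi_j:[0,T_j]\to\mathbb R^n$, $j=0,1,2,\dots$, with $0\le T_j<\infty$, $\dot\varphi_j=f(\varphi_j)$, $\varphi_j(t)\notin S$ for $t<T_j$, $\varphi_j(T_j)\in S$ and $\varphi_{j+1}(0)=g(\varphi_j(T_j))$; it starts at $\varphi_0(0)$ (and $T_0=0$ if it starts on $S$). Assume that $K$ is a tube which the flow traverses up to $S$ and which is forward invariant: (a) $f(x)\ne0$ for $x\in K$, and $z'f(x)\neq 0$ for $x\in K\cap S$; (b) near each point $x\in K\cap S$ the set $K$ lies on the side of $S$ from which the flow arrives: $c(y)\cdot z'f(x)\le0$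 for all $y\in K$ close to $x$; (c) from every point of $K$ the flow $\dot x=f(x)$ reaches $S$ in finite time, and stays in $K$ until then; (d) $g(x)\in K\setminus S$ for $x\in K\cap S$. **Theorem.** Suppose that 1. the flow is transverse contracting on $K$ with some rate $\lambda>0$: for all $x\in K$ and all $\delta\neq0$ with $\frac{\partial V}{\partial\delta}(x,\delta)f(x)=0$ (equivalently $\delta'M(x)f(x)=0$), $$\frac{\partial V}{\partial x}(x,\delta)f(x)+\frac{\partial V}{\partial\delta}(x,\delta)\frac{\partial f}{\partial x}(x)\,\delta\le-\lambda V(x,\delta);$$ 2. the flow meets $S$ $M$-orthogonally: $f(x)'M(x)\delta=0$ for all $x\in K\cap S$ and all $\delta$ tangent to $S$ (that is, $z'\delta=0$); 3. for all $x\in K\cap S$ and all $\delta$ with $\delta'M(x)f(x)=0$, $$\delta'\Big(\frac{\partial g}{\partial x}(x)'\,M(g(x))\,\frac{\partial g}{\partial x}(x)-M(x)\Big)\delta\le0 .$$ Then every solution that starts in $K$ runs for all times ($\sum_jT_j=\infty$), and all solutions in $K$ are Zhukovski stable with uniform constants: for every $\varepsilon>0$ there is $r>0$, the same for all solutions in $K$,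 such that for any two solutions $(\varphi_j,T_j)$, $(\psi_j,T_j')$ that start in $K$ with $\|\varphi_0(0)-\psi_0(0)\|<r$ there are increasing homeomorphisms $\theta_j$ of $[0,1]$ (a time reparameterization $sT_j\mapsto\theta_j(s)T_j'$ of each phase) with $$\big\|\varphi_j(sT_j)-\psi_j(\theta_j(s)T_j')\big\|<\varepsilon\qquad\text{for all } j\ge 0,\ s\in[0,1].$$ -/

import Mathlib

open Set Filter Topology
open scoped ContDiff InnerProductSpace

noncomputable section

namespace HybridContraction

variable {n : ℕ}

/-- The state space `ℝⁿ` with its Euclidean norm. -/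
abbrev State (n : ℕ) : Type := EuclideanSpace ℝ (Fin n)

/-- `M` is a smooth Riemannian metric on `U`: the operator `M x` (a matrix acting on column
vectors) depends smoothly on `x` and is symmetric and positive definite. -/
structure IsMetricOn (M : State n → State n →L[ℝ] State n) (U : Set (State n)) : Prop where
  smooth : ContDiffOn ℝ ∞ M U
  symm : ∀ x ∈ U, ∀ u v : State n, ⟪M x u, v⟫_ℝ = ⟪u, M x v⟫_ℝ
  pos : ∀ x ∈ U, ∀ u : State n, u ≠ 0 → 0 < ⟪u, M x u⟫_ℝ

/-- The length `V(x, δ) = √(δ' M(x) δ)` of the displacement `δ` at `x`. -/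
def metricLength (M : State n → State n →L[ℝ] State n) (x δ : State n) : ℝ :=
  Real.sqrt ⟪δ, M x δ⟫_ℝ

/-- The flow `ẋ = f(x)` is transverse contracting on `K` with rate `rate` in the metric `M`:
`∂V/∂x · f + ∂V/∂δ · (∂f/∂x δ) ≤ - rate * V` for all `δ ≠ 0` with `∂V/∂δ · f = 0`. -/
def TransverseContractingOn (f : State n → State n) (M : State n → State n →L[ℝ] State n)
    (K : Set (State n)) (rate : ℝ) : Prop :=
  ∀ x ∈ K, ∀ δ : State n, δ ≠ 0 →
    fderiv ℝ (fun η => metricLength M x η) δ (f x) = 0 →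
    fderiv ℝ (fun y => metricLength M y δ) x (f x)
        + fderiv ℝ (fun η => metricLength M x η) δ (fderiv ℝ f x δ)
      ≤ -rate * metricLength M x δ

/-- The flat switching surface `S = {x | c(x) = 0}`, where `c(x) = z ⬝ x - b`. -/
def switchingSurface (z : State n) (b : ℝ) : Set (State n) := {x | ⟪z, x⟫_ℝ - b = 0}

/-- One continuous phase: `φ` solves `ẋ = f(x)` on `[0, T]` and hits `S` at time `T` and not
before. If `φ 0 ∈ S` then `T = 0`: the phase consists of the point `φ 0` alone. -/
structure IsPhase (f : State n → State n) (S : Set (State n)) (T : ℝ) (φ : ℝ → State n) :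
    Prop where
  nonneg : 0 ≤ T
  flow : ∀ t ∈ Icc 0 T, HasDerivWithinAt φ (f (φ t)) (Icc 0 T) t
  off : ∀ t ∈ Ico 0 T, φ t ∉ S
  hit : φ T ∈ S

/-- A solution of the hybrid system `ẋ = f(x)` for `x ∉ S`, `x⁺ = g(x)` for `x ∈ S`, given by its
successive continuous phases `arc 0, arc 1, …` of durations `dur 0, dur 1, …`. -/
structure HybridSolution (f g : State n → State n) (S : Set (State n)) where
  dur : ℕ → ℝ
  arc : ℕ → ℝ → State n
  phase : ∀ j, IsPhase f S (dur j) (arc j)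
  jump : ∀ j, arc (j + 1) 0 = g (arc j (dur j))

/-- The initial state of a solution. -/
def HybridSolution.init {f g : State n → State n} {S : Set (State n)}
    (X : HybridSolution f g S) : State n := X.arc 0 0

/-- Up to a time reparameterization, the solution `Y` stays within distance `ε` of the solution
`X` for ever. The reparameterization matches the jumps, and inside the `j`-th phase it is the
increasing homeomorphism `s * X.dur j ↦ θ j s * Y.dur j` from `[0, X.dur j]` to `[0, Y.dur j]`,
where `θ j` is an increasing homeomorphism of `[0, 1]`. (Using the fraction `s` of the phase as
parameter also covers an initial phase of duration `0`, for a solution that starts on `S`.) -/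
def StaysCloseUpToTime {f g : State n → State n} {S : Set (State n)}
    (X Y : HybridSolution f g S) (ε : ℝ) : Prop :=
  ∃ θ : ℕ → (Icc (0 : ℝ) 1 ≃o Icc (0 : ℝ) 1), ∀ (j : ℕ) (s : Icc (0 : ℝ) 1),
    dist (X.arc j ((s : ℝ) * X.dur j)) (Y.arc j ((θ j s : ℝ) * Y.dur j)) < ε

end HybridContraction

end

/-!
The distance between two solutions is measured across the flow only. Write `δ` for the
displacement between two points of `K`, and let its *transverse energy* be the least squared
`M`-length of `δ - a f` over all real `a`. Along two flow lines with the same clock, transverse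
contraction makes this energy decay at the rate `2 * rate`, up to an error of third order in the
distance (`transverseEnergy_decay`): the linearized flow maps `f` to `f`, so the component along
the flow never feeds back into the transverse one. Over the bounded duration of a phase the full
distance grows by at most a constant factor. Only linearization at points of `K` along the actual
solutions enters, so `K` need not be convex or connected.

Close to the surface the remaining time is at most proportional to the distance
(`exists_arrival_bound`). Hence the durations of the phases are bounded, and two neighbouring phases
differ in duration by a multiple of their initial distance (`exists_phase_bound`). When the later
one arrives, the displacement between the two end points is tangent to the flat surface, hence
`M`-orthogonal to `f`: its squared length is its transverse energy, which up to third order is the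
one at the first arrival (`pairEnergy_phase_le`). The jump does not increase it, up to third
order (`pairEnergy_jump_le`). Phases after a jump have a least duration, since `g` maps `K ∩ S` off
`S`; this gives the infinite total time and a contraction factor less than `1`, which dominates the
errors of third order when the solutions are close (`exists_pairEnergy_antitone`). So the energy at
the start of the phases is nonincreasing from the first jump on, and the initial phase, however
short, with its jump costs only a constant factor. Inside a phase the linear change of time already
keeps the solutions close, so every `θ j` is the identity.
-/

namespace HybridContraction

/-! ### Second-order bounds on a compact set -/

/-- The linearization error of a smooth map is quadratic, uniformly over pairs of points of a
compact set. The segment between the two points may leave the set: near the diagonal of `K × K`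
it still lies in the domain of smoothness, and away from the diagonal the quotient of the error by
`‖y - x‖ ^ 2` is continuous. -/
theorem exists_linearization_bound {E F : Type*} [NormedAddCommGroup E] [NormedSpace ℝ E]
    [NormedAddCommGroup F] [NormedSpace ℝ F] {h : E → F} {U K : Set E}
    (hU : IsOpen U) (hK : IsCompact K) (hKU : K ⊆ U) (hh : ContDiffOn ℝ ∞ h U) :
    ∃ C, 0 ≤ C ∧ ∀ x ∈ K, ∀ y ∈ K, ‖h y - h x - fderiv ℝ h x (y - x)‖ ≤ C * ‖y - x‖ ^ 2 := by
  have key : ∃ C, 0 ≤ C ∧ ∀ p ∈ K ×ˢ K,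
      ‖h p.2 - h p.1 - fderiv ℝ h p.1 (p.2 - p.1)‖ ≤ C * ‖p.2 - p.1‖ ^ 2 := by
    refine (hK.prod hK).induction_on (p := fun s => ∃ C, 0 ≤ C ∧ ∀ p ∈ s,
      ‖h p.2 - h p.1 - fderiv ℝ h p.1 (p.2 - p.1)‖ ≤ C * ‖p.2 - p.1‖ ^ 2)
      ⟨0, le_rfl, by simp⟩ ?_ ?_ ?_
    · rintro s t hst ⟨C, hC, H⟩
      exact ⟨C, hC, fun p hp => H p (hst hp)⟩
    · rintro s t ⟨C, hC, H⟩ ⟨C', hC', H'⟩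
      refine ⟨max C C', le_max_of_le_left hC, ?_⟩
      rintro p (hp | hp)
      · exact (H p hp).trans (by gcongr; exact le_max_left _ _)
      · exact (H' p hp).trans (by gcongr; exact le_max_right _ _)
    · rintro ⟨x₀, y₀⟩ ⟨hx₀, hy₀⟩
      have hxU : U ∈ 𝓝 x₀ := hU.mem_nhds (hKU hx₀)
      have hyU : U ∈ 𝓝 y₀ := hU.mem_nhds (hKU hy₀)
      have hxc : ContDiffAt ℝ ∞ h x₀ := hh.contDiffAt hxU
      have hyc : ContDiffAt ℝ ∞ h y₀ := hh.contDiffAt hyU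
      have hd : ContDiffAt ℝ 1 (fderiv ℝ h) x₀ := hxc.fderiv_right (by norm_cast)
      by_cases hxy : x₀ = y₀
      · subst hxy
        obtain ⟨L, t, ht, hL⟩ := hd.exists_lipschitzOnWith
        obtain ⟨ρ, hρ, hball⟩ := Metric.mem_nhds_iff.1 (inter_mem ht hxU)
        refine ⟨Metric.ball x₀ ρ ×ˢ Metric.ball x₀ ρ, mem_nhdsWithin_of_mem_nhds
          (prod_mem_nhds (Metric.ball_mem_nhds _ hρ) (Metric.ball_mem_nhds _ hρ)), L, L.2, ?_⟩
        rintro ⟨x, y⟩ ⟨hx, hy⟩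
        have hseg : segment ℝ x y ⊆ Metric.ball x₀ ρ := (convex_ball x₀ ρ).segment_subset hx hy
        have := Convex.norm_image_sub_le_of_norm_fderiv_le' (𝕜 := ℝ) (f := h) (s := segment ℝ x y)
          (x := x) (y := y) (φ := fderiv ℝ h x) (C := L * ‖y - x‖)
          (fun w hw => (hh.contDiffAt (hU.mem_nhds (hball (hseg hw)).2)).differentiableAt
            (by simp)) ?_ (convex_segment x y) (left_mem_segment ℝ x y) (right_mem_segment ℝ x y)
        · calc _ ≤ L * ‖y - x‖ * ‖y - x‖ := this
            _ = L * ‖y - x‖ ^ 2 := by ring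
        · intro w hw
          refine (hL.norm_sub_le (hball (hseg hw)).1 (hball hx).1).trans ?_
          gcongr
          exact norm_sub_le_of_mem_segment hw
      · have hcont : ContinuousAt (fun p : E × E =>
            ‖h p.2 - h p.1 - fderiv ℝ h p.1 (p.2 - p.1)‖ / ‖p.2 - p.1‖ ^ 2) (x₀, y₀) := by
          have h1 : ContinuousAt (fun p : E × E => h p.1) (x₀, y₀) :=
            ContinuousAt.comp' (f := Prod.fst) (x := (x₀, y₀)) hxc.continuousAt continuousAt_fst
          have h2 : ContinuousAt (fun p : E × E => h p.2) (x₀, y₀) :=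
            ContinuousAt.comp' (f := Prod.snd) (x := (x₀, y₀)) hyc.continuousAt continuousAt_snd
          have h3 : ContinuousAt (fun p : E × E => fderiv ℝ h p.1) (x₀, y₀) :=
            ContinuousAt.comp' (f := Prod.fst) (x := (x₀, y₀)) hd.continuousAt continuousAt_fst
          have h4 : ContinuousAt (fun p : E × E => p.2 - p.1) (x₀, y₀) := by fun_prop
          refine ((h2.sub h1).sub (h3.clm_apply h4)).norm.div (h4.norm.pow 2) ?_
          simpa [sub_eq_zero] using fun h => hxy h.symm
        refine ⟨_, mem_nhdsWithin_of_mem_nhds ((hcont.eventually_lt continuousAt_const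
          (lt_add_one _)).and ((continuous_snd.sub continuous_fst).continuousAt.eventually_ne
          (sub_ne_zero.2 (Ne.symm hxy)))),
          ‖h y₀ - h x₀ - fderiv ℝ h x₀ (y₀ - x₀)‖ / ‖y₀ - x₀‖ ^ 2 + 1, by positivity, ?_⟩
        rintro ⟨x, y⟩ ⟨hp, hne⟩
        have hpos : 0 < ‖y - x‖ ^ 2 := by
          have : 0 < ‖y - x‖ := norm_pos_iff.2 hne
          positivity
        exact ((div_lt_iff₀ hpos).1 hp).le
  obtain ⟨C, hC, H⟩ := key
  exact ⟨C, hC, fun x hx y hy => H (x, y) ⟨hx, hy⟩⟩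

/-- A smooth map is Lipschitz on a compact set, also if that set is not convex. -/
theorem exists_lipschitz_bound {E F : Type*} [NormedAddCommGroup E] [NormedSpace ℝ E]
    [NormedAddCommGroup F] [NormedSpace ℝ F] {h : E → F} {U K : Set E}
    (hU : IsOpen U) (hK : IsCompact K) (hKU : K ⊆ U) (hh : ContDiffOn ℝ ∞ h U) :
    ∃ C, 0 ≤ C ∧ ∀ x ∈ K, ∀ y ∈ K, ‖h y - h x‖ ≤ C * ‖y - x‖ := by
  obtain ⟨C, hC, H⟩ := exists_linearization_bound hU hK hKU hh
  have hd : ContinuousOn (fderiv ℝ h) K :=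
    (hh.continuousOn_fderiv_of_isOpen hU (by simp)).mono hKU
  obtain ⟨B, hB⟩ := hK.exists_bound_of_continuousOn hd
  obtain ⟨R, hR⟩ := hK.isBounded.exists_norm_le
  refine ⟨max B 0 + C * (2 * max R 0), by positivity, fun x hx y hy => ?_⟩
  have h1 := H x hx y hy
  have h2 : ‖fderiv ℝ h x (y - x)‖ ≤ max B 0 * ‖y - x‖ :=
    (fderiv ℝ h x).le_of_opNorm_le ((hB x hx).trans (le_max_left _ _)) _
  have h3 : ‖y - x‖ ≤ 2 * max R 0 := by
    have := norm_sub_le y x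
    have := hR x hx
    have := hR y hy
    have := le_max_left R 0
    linarith
  have h4 : ‖h y - h x‖ ≤ ‖h y - h x - fderiv ℝ h x (y - x)‖ + ‖fderiv ℝ h x (y - x)‖ := by
    simpa using norm_add_le (h y - h x - fderiv ℝ h x (y - x)) (fderiv ℝ h x (y - x))
  calc ‖h y - h x‖ ≤ C * ‖y - x‖ ^ 2 + max B 0 * ‖y - x‖ := by linarith
    _ = C * ‖y - x‖ * ‖y - x‖ + max B 0 * ‖y - x‖ := by ring
    _ ≤ C * (2 * max R 0) * ‖y - x‖ + max B 0 * ‖y - x‖ := by gcongr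
    _ = _ := by ring

variable {n : ℕ}

theorem IsMetricOn.inner_nonneg {M : State n → State n →L[ℝ] State n} {U : Set (State n)}
    (hM : IsMetricOn M U) {x : State n} (hx : x ∈ U) (u : State n) : 0 ≤ ⟪u, M x u⟫_ℝ := by
  rcases eq_or_ne u 0 with rfl | hu
  · simp
  · exact (hM.pos x hx u hu).le

/-- A metric is uniformly positive definite on a compact set. -/
theorem IsMetricOn.exists_norm_sq_le {M : State n → State n →L[ℝ] State n} {U K : Set (State n)}
    (hM : IsMetricOn M U) (hK : IsCompact K) (hKU : K ⊆ U) :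
    ∃ C, 0 ≤ C ∧ ∀ x ∈ K, ∀ u : State n, ‖u‖ ^ 2 ≤ C * ⟪u, M x u⟫_ℝ := by
  have hc : ContinuousOn (fun p : State n × State n => ⟪p.2, M p.1 p.2⟫_ℝ)
      (K ×ˢ Metric.sphere (0 : State n) 1) := by
    have h1 : ContinuousOn (fun p : State n × State n => M p.1)
        (K ×ˢ Metric.sphere (0 : State n) 1) :=
      hM.smooth.continuousOn.comp continuousOn_fst fun p hp => hKU hp.1
    exact continuousOn_snd.inner (h1.clm_apply continuousOn_snd)
  obtain ⟨m, hm, H⟩ := (hK.prod (isCompact_sphere (0 : State n) 1)).exists_forall_le' hc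
    (a := 0) (fun p hp => hM.pos p.1 (hKU hp.1) p.2 (by
      have : ‖p.2‖ = 1 := by simpa using hp.2
      exact norm_ne_zero_iff.1 (by simp [this])))
  refine ⟨m⁻¹, by positivity, fun x hx u => ?_⟩
  rcases eq_or_ne u 0 with rfl | hu
  · simp
  have hu' : 0 < ‖u‖ := norm_pos_iff.2 hu
  have := H (x, ‖u‖⁻¹ • u) ⟨hx, by simp [norm_smul, hu]⟩
  simp only [map_smul, inner_smul_left, inner_smul_right, conj_trivial] at this
  rw [inv_mul_eq_div, le_div_iff₀ hm]
  calc ‖u‖ ^ 2 * m ≤ ‖u‖ ^ 2 * (‖u‖⁻¹ * (‖u‖⁻¹ * ⟪u, M x u⟫_ℝ)) := by gcongr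
    _ = ⟪u, M x u⟫_ℝ := by field_simp

/-- The constant `C` bounds all the data on `K` that enter the estimates: sizes, Lipschitz
constants and linearization errors of `f`, `g` and `M`, and the reciprocal of the lower bound of
the metric. -/
structure IsTubeBound (f g : State n → State n) (M : State n → State n →L[ℝ] State n)
    (K : Set (State n)) (C : ℝ) : Prop where
  one_le : 1 ≤ C
  speed : ∀ x ∈ K, ‖f x‖ ≤ C
  metric : ∀ x ∈ K, ‖M x‖ ≤ C
  norm_sq_le : ∀ x ∈ K, ∀ u : State n, ‖u‖ ^ 2 ≤ C * ⟪u, M x u⟫_ℝ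
  lip_f : ∀ x ∈ K, ∀ y ∈ K, ‖f y - f x‖ ≤ C * ‖y - x‖
  lip_g : ∀ x ∈ K, ∀ y ∈ K, ‖g y - g x‖ ≤ C * ‖y - x‖
  lip_M : ∀ x ∈ K, ∀ y ∈ K, ‖M y - M x‖ ≤ C * ‖y - x‖
  lin_f : ∀ x ∈ K, ∀ y ∈ K, ‖f y - f x - fderiv ℝ f x (y - x)‖ ≤ C * ‖y - x‖ ^ 2
  lin_g : ∀ x ∈ K, ∀ y ∈ K, ‖g y - g x - fderiv ℝ g x (y - x)‖ ≤ C * ‖y - x‖ ^ 2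

theorem exists_isTubeBound {f g : State n → State n} {M : State n → State n →L[ℝ] State n}
    {U K : Set (State n)} (hU : IsOpen U) (hK : IsCompact K) (hKU : K ⊆ U)
    (hf : ContDiffOn ℝ ∞ f U) (hg : ContDiffOn ℝ ∞ g U) (hM : IsMetricOn M U) :
    ∃ C, IsTubeBound f g M K C := by
  obtain ⟨a1, h1⟩ := hK.exists_bound_of_continuousOn (hf.continuousOn.mono hKU)
  obtain ⟨a2, h2⟩ := hK.exists_bound_of_continuousOn (hM.smooth.continuousOn.mono hKU)
  obtain ⟨a3, -, h3⟩ := hM.exists_norm_sq_le hK hKU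
  obtain ⟨a4, -, h4⟩ := exists_lipschitz_bound hU hK hKU hf
  obtain ⟨a5, -, h5⟩ := exists_lipschitz_bound hU hK hKU hg
  obtain ⟨a6, -, h6⟩ := exists_lipschitz_bound hU hK hKU hM.smooth
  obtain ⟨a7, -, h7⟩ := exists_linearization_bound hU hK hKU hf
  obtain ⟨a8, -, h8⟩ := exists_linearization_bound hU hK hKU hg
  obtain ⟨C, hC⟩ := (Set.toFinite {1, a1, a2, a3, a4, a5, a6, a7, a8}).bddAbove
  have hC' : ∀ c ∈ ({1, a1, a2, a3, a4, a5, a6, a7, a8} : Set ℝ), c ≤ C := fun c hc => hC hc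
  simp only [mem_insert_iff, mem_singleton_iff, forall_eq_or_imp, forall_eq] at hC'
  obtain ⟨c0, c1, c2, c3, c4, c5, c6, c7, c8⟩ := hC'
  exact ⟨C, c0, fun x hx => (h1 x hx).trans c1, fun x hx => (h2 x hx).trans c2,
    fun x hx u => (h3 x hx u).trans (mul_le_mul_of_nonneg_right c3 (hM.inner_nonneg (hKU hx) u)),
    fun x hx y hy => (h4 x hx y hy).trans (by gcongr),
    fun x hx y hy => (h5 x hx y hy).trans (by gcongr),
    fun x hx y hy => (h6 x hx y hy).trans (by gcongr),
    fun x hx y hy => (h7 x hx y hy).trans (by gcongr),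
    fun x hx y hy => (h8 x hx y hy).trans (by gcongr)⟩

/-! ### The transverse energy and its decay along the flow -/

/-- Transverse contraction as an inequality between quadratic forms: the derivative of the squared
length of a transverse displacement that is carried along by the linearized flow. -/
theorem TransverseContractingOn.quadratic_le {f : State n → State n}
    {M : State n → State n →L[ℝ] State n} {U K : Set (State n)} {rate : ℝ}
    (h : TransverseContractingOn f M K rate) (hU : IsOpen U) (hKU : K ⊆ U)
    (hM : IsMetricOn M U) {x : State n} (hx : x ∈ K) {ξ : State n}
    (hξ : ⟪ξ, M x (f x)⟫_ℝ = 0) :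
    ⟪ξ, fderiv ℝ M x (f x) ξ⟫_ℝ + 2 * ⟪fderiv ℝ f x ξ, M x ξ⟫_ℝ
      ≤ -(2 * rate) * ⟪ξ, M x ξ⟫_ℝ := by
  rcases eq_or_ne ξ 0 with rfl | hne
  · simp
  have hpos : 0 < ⟪ξ, M x ξ⟫_ℝ := hM.pos x (hKU hx) ξ hne
  have hη : ∀ v, fderiv ℝ (fun η => metricLength M x η) ξ v
      = ⟪v, M x ξ⟫_ℝ / Real.sqrt ⟪ξ, M x ξ⟫_ℝ := by
    intro v
    have h1 : HasFDerivAt (fun η : State n => ⟪η, M x η⟫_ℝ) _ ξ :=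
      (hasFDerivAt_id ξ).inner ℝ (M x).hasFDerivAt
    have h2 := (h1.sqrt hpos.ne').fderiv
    have h3 : ⟪ξ, M x v⟫_ℝ = ⟪v, M x ξ⟫_ℝ := by
      rw [← hM.symm x (hKU hx), real_inner_comm]
    change fderiv ℝ (fun η => Real.sqrt ⟪η, M x η⟫_ℝ) ξ v = _
    rw [h2]
    simp [h3]
    field_simp
    ring
  have hy : fderiv ℝ (fun y => metricLength M y ξ) x (f x)
      = ⟪ξ, fderiv ℝ M x (f x) ξ⟫_ℝ / (2 * Real.sqrt ⟪ξ, M x ξ⟫_ℝ) := by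
    have h0 : HasFDerivAt M (fderiv ℝ M x) x :=
      ((hM.smooth.contDiffAt (hU.mem_nhds (hKU hx))).differentiableAt (by simp)).hasFDerivAt
    have h1 : HasFDerivAt (fun y : State n => ⟪ξ, M y ξ⟫_ℝ) _ x :=
      (hasFDerivAt_const ξ x).inner ℝ (h0.clm_apply (hasFDerivAt_const ξ x))
    have h2 := (h1.sqrt hpos.ne').fderiv
    change fderiv ℝ (fun y => Real.sqrt ⟪ξ, M y ξ⟫_ℝ) x (f x) = _
    rw [h2]
    simp
    field_simp
  have hs : 0 < Real.sqrt ⟪ξ, M x ξ⟫_ℝ := Real.sqrt_pos.2 hpos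
  have := h x hx ξ hne (by
    rw [hη, real_inner_comm, hM.symm x (hKU hx), hξ, zero_div])
  rw [hη, hy, metricLength] at this
  have h5 := mul_le_mul_of_nonneg_right this hs.le
  have h6 := Real.mul_self_sqrt hpos.le
  have h7 : (⟪ξ, fderiv ℝ M x (f x) ξ⟫_ℝ / (2 * Real.sqrt ⟪ξ, M x ξ⟫_ℝ)
      + ⟪fderiv ℝ f x ξ, M x ξ⟫_ℝ / Real.sqrt ⟪ξ, M x ξ⟫_ℝ) * Real.sqrt ⟪ξ, M x ξ⟫_ℝ
      = ⟪ξ, fderiv ℝ M x (f x) ξ⟫_ℝ / 2 + ⟪fderiv ℝ f x ξ, M x ξ⟫_ℝ := by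
    field_simp
  rw [h7, mul_assoc, h6] at h5
  linarith

/-- The component of the displacement `δ` at `x` that is `M`-orthogonal to the flow direction. -/
noncomputable def transversePart (f : State n → State n) (M : State n → State n →L[ℝ] State n)
    (x δ : State n) : State n :=
  δ - (⟪δ, M x (f x)⟫_ℝ / ⟪f x, M x (f x)⟫_ℝ) • f x

/-- The squared `M`-length of the transverse component of `δ`, which is the least squared
`M`-length of a displacement that differs from `δ` by a multiple of `f x`. -/
noncomputable def transverseEnergy (f : State n → State n) (M : State n → State n →L[ℝ] State n)
    (x δ : State n) : ℝ :=
  ⟪transversePart f M x δ, M x (transversePart f M x δ)⟫_ℝ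

theorem inner_transversePart {f : State n → State n} {M : State n → State n →L[ℝ] State n}
    {x : State n} (h : ⟪f x, M x (f x)⟫_ℝ ≠ 0) (δ : State n) :
    ⟪transversePart f M x δ, M x (f x)⟫_ℝ = 0 := by
  simp [transversePart, inner_sub_left, inner_smul_left, h]

theorem transverseEnergy_le {f : State n → State n} {M : State n → State n →L[ℝ] State n}
    {U : Set (State n)} (hM : IsMetricOn M U) {x : State n} (hx : x ∈ U) (hfx : f x ≠ 0)
    (δ : State n) (a : ℝ) :
    transverseEnergy f M x δ ≤ ⟪δ - a • f x, M x (δ - a • f x)⟫_ℝ := by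
  have hE := hM.pos x hx (f x) hfx
  have h0 := inner_transversePart (δ := δ) hE.ne'
  have h0' : ⟪f x, M x (transversePart f M x δ)⟫_ℝ = 0 := by
    rw [← hM.symm x hx, real_inner_comm, h0]
  have hδ : δ - a • f x = transversePart f M x δ
      + (⟪δ, M x (f x)⟫_ℝ / ⟪f x, M x (f x)⟫_ℝ - a) • f x := by
    simp only [transversePart, sub_smul]; abel
  rw [hδ, transverseEnergy]
  generalize ⟪δ, M x (f x)⟫_ℝ / ⟪f x, M x (f x)⟫_ℝ - a = c
  simp only [map_add, map_smul, inner_add_left, inner_add_right, inner_smul_left,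
    inner_smul_right, h0, h0', conj_trivial]
  nlinarith [mul_nonneg (mul_self_nonneg c) hE.le]

theorem transverseEnergy_le_self {f : State n → State n} {M : State n → State n →L[ℝ] State n}
    {U : Set (State n)} (hM : IsMetricOn M U) {x : State n} (hx : x ∈ U) (hfx : f x ≠ 0)
    (δ : State n) : transverseEnergy f M x δ ≤ ⟪δ, M x δ⟫_ℝ := by
  simpa using transverseEnergy_le hM hx hfx δ 0

theorem IsTubeBound.inner_le {f g : State n → State n} {M : State n → State n →L[ℝ] State n}
    {K : Set (State n)} {C : ℝ} (hC : IsTubeBound f g M K C) {x : State n} (hx : x ∈ K)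
    (u v : State n) : ⟪u, M x v⟫_ℝ ≤ C * ‖u‖ * ‖v‖ :=
  calc ⟪u, M x v⟫_ℝ ≤ ‖u‖ * ‖M x v‖ := real_inner_le_norm _ _
    _ ≤ ‖u‖ * (C * ‖v‖) := by gcongr; exact (M x).le_of_opNorm_le (hC.metric x hx) v
    _ = _ := by ring

theorem IsTubeBound.norm_transversePart_le {f g : State n → State n}
    {M : State n → State n →L[ℝ] State n} {U K : Set (State n)} {C : ℝ}
    (hC : IsTubeBound f g M K C) (hM : IsMetricOn M U) (hKU : K ⊆ U) {x : State n} (hx : x ∈ K)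
    (hfx : f x ≠ 0) (δ : State n) : ‖transversePart f M x δ‖ ≤ C * ‖δ‖ := by
  have h0 := zero_le_one.trans hC.one_le
  have h1 := hC.norm_sq_le x hx (transversePart f M x δ)
  have h2 := transverseEnergy_le_self hM (hKU hx) hfx δ
  have h3 := hC.inner_le hx δ δ
  refine abs_le_of_sq_le_sq' ?_ (by positivity) |>.2
  calc ‖transversePart f M x δ‖ ^ 2 ≤ C * transverseEnergy f M x δ := h1
    _ ≤ C * (C * ‖δ‖ * ‖δ‖) := by gcongr; exact h2.trans h3
    _ = (C * ‖δ‖) ^ 2 := by ring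

/-- Along two flow lines that run in `K` with the same clock, the transverse energy of their
difference decays at the rate `2 * rate`, up to an error of third order in the distance. No
synchronization of the flow lines is needed, because the linearized flow maps `f` to `f`. -/
theorem transverseEnergy_decay {f g : State n → State n} {M : State n → State n →L[ℝ] State n}
    {U K : Set (State n)} {C rate : ℝ} (hC : IsTubeBound f g M K C) (hU : IsOpen U)
    (hKU : K ⊆ U) (hf : ContDiffOn ℝ ∞ f U) (hM : IsMetricOn M U) (hf_ne : ∀ x ∈ K, f x ≠ 0)
    (hrate : 0 < rate) (hcontr : TransverseContractingOn f M K rate)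
    {T d : ℝ} (hT : 0 ≤ T) {x y : ℝ → State n}
    (hx : ∀ t ∈ Icc 0 T, HasDerivWithinAt x (f (x t)) (Icc 0 T) t)
    (hy : ∀ t ∈ Icc 0 T, HasDerivWithinAt y (f (y t)) (Icc 0 T) t)
    (hxK : ∀ t ∈ Icc 0 T, x t ∈ K) (hyK : ∀ t ∈ Icc 0 T, y t ∈ K)
    (hd : ∀ t ∈ Icc 0 T, ‖y t - x t‖ ≤ d) :
    transverseEnergy f M (x T) (y T - x T) ≤
      Real.exp (-(2 * rate) * T) * transverseEnergy f M (x 0) (y 0 - x 0)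
        + C ^ 3 / rate * d ^ 3 := by
  have hC0 : 0 ≤ C := zero_le_one.trans hC.one_le
  have hd0 : 0 ≤ d := (norm_nonneg _).trans (hd 0 (left_mem_Icc.2 hT))
  have hE : ∀ t ∈ Icc 0 T, ⟪f (x t), M (x t) (f (x t))⟫_ℝ ≠ 0 := fun t ht =>
    (hM.pos _ (hKU (hxK t ht)) _ (hf_ne _ (hxK t ht))).ne'
  have hxc : ContinuousOn x (Icc 0 T) := fun t ht => (hx t ht).continuousWithinAt
  have hyc : ContinuousOn y (Icc 0 T) := fun t ht => (hy t ht).continuousWithinAt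
  have hcont : ContinuousOn (fun t => transverseEnergy f M (x t) (y t - x t)) (Icc 0 T) := by
    have hfc : ContinuousOn (fun t => f (x t)) (Icc 0 T) :=
      hf.continuousOn.comp hxc fun t ht => hKU (hxK t ht)
    have hMc : ContinuousOn (fun t => M (x t)) (Icc 0 T) :=
      hM.smooth.continuousOn.comp hxc fun t ht => hKU (hxK t ht)
    have hδc : ContinuousOn (fun t => y t - x t) (Icc 0 T) := hyc.sub hxc
    have hPc : ContinuousOn (fun t => transversePart f M (x t) (y t - x t)) (Icc 0 T) :=
      hδc.sub (((hδc.inner (hMc.clm_apply hfc)).div (hfc.inner (hMc.clm_apply hfc)) hE).smul hfc)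
    exact hPc.inner (hMc.clm_apply hPc)
  -- the derivative of the squared length of `δ - a f`, with `a` frozen at its value at time `t`
  set W' : ℝ → ℝ := fun t =>
    let ξ := transversePart f M (x t) (y t - x t)
    let η := f (y t) - f (x t)
      - (⟪y t - x t, M (x t) (f (x t))⟫_ℝ / ⟪f (x t), M (x t) (f (x t))⟫_ℝ) •
        fderiv ℝ f (x t) (f (x t))
    ⟪ξ, fderiv ℝ M (x t) (f (x t)) ξ + M (x t) η⟫_ℝ + ⟪η, M (x t) ξ⟫_ℝ with hW'
  have hbound : ∀ t ∈ Ico 0 T,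
      W' t ≤ -(2 * rate) * transverseEnergy f M (x t) (y t - x t) + 2 * C ^ 3 * d ^ 3 := by
    intro t ht
    have ht' := Ico_subset_Icc_self ht
    have hK := hxK t ht'
    set δ := y t - x t with hδ
    set ξ := transversePart f M (x t) δ with hξ
    have h1 := hcontr.quadratic_le hU hKU hM hK (ξ := ξ)
      (inner_transversePart (hE t ht') δ)
    set R := f (y t) - f (x t) - fderiv ℝ f (x t) (y t - x t) with hR
    have hη : f (y t) - f (x t)
        - (⟪δ, M (x t) (f (x t))⟫_ℝ / ⟪f (x t), M (x t) (f (x t))⟫_ℝ) •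
          fderiv ℝ f (x t) (f (x t)) = fderiv ℝ f (x t) ξ + R := by
      simp only [hξ, transversePart, map_sub, map_smul, hR, ← hδ]; abel
    have h2 : W' t = ⟪ξ, fderiv ℝ M (x t) (f (x t)) ξ⟫_ℝ + 2 * ⟪fderiv ℝ f (x t) ξ, M (x t) ξ⟫_ℝ
        + 2 * ⟪R, M (x t) ξ⟫_ℝ := by
      simp only [hW', ← hδ, ← hξ, hη]
      have hs : ∀ w, ⟪ξ, M (x t) w⟫_ℝ = ⟪w, M (x t) ξ⟫_ℝ := fun w => by
        rw [← hM.symm _ (hKU hK), real_inner_comm]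
      simp only [inner_add_right, inner_add_left, map_add, hs]
      ring
    have h3 : ⟪R, M (x t) ξ⟫_ℝ ≤ C ^ 3 * d ^ 3 := by
      have hδd : ‖δ‖ ≤ d := hd t ht'
      have hR' : ‖R‖ ≤ C * d ^ 2 :=
        (hC.lin_f _ hK _ (hyK t ht')).trans (by gcongr)
      have hξ' : ‖ξ‖ ≤ C * d :=
        (hC.norm_transversePart_le hM hKU hK (hf_ne _ hK) δ).trans (by gcongr)
      calc ⟪R, M (x t) ξ⟫_ℝ ≤ C * ‖R‖ * ‖ξ‖ := hC.inner_le hK _ _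
        _ ≤ C * (C * d ^ 2) * (C * d) := by gcongr
        _ = _ := by ring
    rw [h2]
    change _ ≤ -(2 * rate) * ⟪ξ, M (x t) ξ⟫_ℝ + _
    linarith
  -- the transverse energy is the minimum over `a` of the squared length of `δ - a f`, so its right
  -- upper slope at time `t` is at most the derivative with the minimizing `a` frozen
  have hslope : ∀ t ∈ Ico 0 T, ∀ r, W' t < r → ∃ᶠ s in 𝓝[>] t, (s - t)⁻¹ *
      (transverseEnergy f M (x s) (y s - x s) - transverseEnergy f M (x t) (y t - x t)) < r := by
    intro t ht r hr
    have ht' := Ico_subset_Icc_self ht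
    have hK := hxK t ht'
    have hI : Icc 0 T ∈ 𝓝[>] t := Icc_mem_nhdsGT_of_mem ht
    set a := ⟪y t - x t, M (x t) (f (x t))⟫_ℝ / ⟪f (x t), M (x t) (f (x t))⟫_ℝ with ha
    have hfd : HasFDerivAt f (fderiv ℝ f (x t)) (x t) :=
      ((hf.contDiffAt (hU.mem_nhds (hKU hK))).differentiableAt (by simp)).hasFDerivAt
    have hMd : HasFDerivAt M (fderiv ℝ M (x t)) (x t) :=
      ((hM.smooth.contDiffAt (hU.mem_nhds (hKU hK))).differentiableAt (by simp)).hasFDerivAt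
    have hx' : HasDerivWithinAt x (f (x t)) (Ioi t) t := (hx t ht').mono_of_mem_nhdsWithin hI
    have hy' : HasDerivWithinAt y (f (y t)) (Ioi t) t := (hy t ht').mono_of_mem_nhdsWithin hI
    have hη : HasDerivWithinAt (fun s => y s - x s - a • f (x s))
        (f (y t) - f (x t) - a • fderiv ℝ f (x t) (f (x t))) (Ioi t) t :=
      (hy'.sub hx').sub ((hfd.comp_hasDerivWithinAt t hx').const_smul a)
    have hw : HasDerivWithinAt
        (fun s => ⟪y s - x s - a • f (x s), M (x s) (y s - x s - a • f (x s))⟫_ℝ) (W' t)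
        (Ioi t) t := by
      have := hη.inner ℝ ((hMd.comp_hasDerivWithinAt t hx').clm_apply hη)
      exact this
    have hlt := hw.limsup_slope_le' (by simp) hr
    refine (((hlt.and hI).and self_mem_nhdsWithin).mono ?_).frequently
    rintro s ⟨⟨hs, hsI⟩, hst⟩
    refine lt_of_le_of_lt ?_ hs
    rw [slope_def_field, div_eq_inv_mul]
    have hst' : 0 < s - t := sub_pos.2 hst
    gcongr
    · exact transverseEnergy_le hM (hKU (hxK s hsI)) (hf_ne _ (hxK s hsI)) _ _
    · exact le_rfl
  have hG := le_gronwallBound_of_liminf_deriv_right_le hcont hslope le_rfl hbound T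
    (right_mem_Icc.2 hT)
  have hK0 : -(2 * rate) ≠ 0 := by linarith
  rw [gronwallBound_of_K_ne_0 hK0, sub_zero] at hG
  beta_reduce at hG
  refine hG.trans ?_
  have he : 2 * C ^ 3 * d ^ 3 / -(2 * rate) * (Real.exp (-(2 * rate) * T) - 1)
      = C ^ 3 / rate * d ^ 3 * (1 - Real.exp (-(2 * rate) * T)) := by
    field_simp
    ring
  have : C ^ 3 / rate * d ^ 3 * (1 - Real.exp (-(2 * rate) * T)) ≤ C ^ 3 / rate * d ^ 3 * 1 := by
    gcongr
    linarith [Real.exp_pos (-(2 * rate) * T)]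
  rw [he, mul_comm (transverseEnergy _ _ _ _)]
  linarith

/-! ### Phases in the tube -/

/-- A phase that runs in the set `K`. -/
structure IsPhaseIn (f : State n → State n) (S K : Set (State n)) (T : ℝ) (φ : ℝ → State n) : Prop
    extends IsPhase f S T φ where
  mem : ∀ t ∈ Icc 0 T, φ t ∈ K

theorem eqOn_Icc_of_flow {f : State n → State n} {U : Set (State n)} (hU : IsOpen U)
    (hf : ContDiffOn ℝ ∞ f U) {T : ℝ} {φ ψ : ℝ → State n}
    (hφ : ∀ t ∈ Icc 0 T, HasDerivWithinAt φ (f (φ t)) (Icc 0 T) t)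
    (hψ : ∀ t ∈ Icc 0 T, HasDerivWithinAt ψ (f (ψ t)) (Icc 0 T) t)
    (hψU : ∀ t ∈ Icc 0 T, ψ t ∈ U) (h0 : φ 0 = ψ 0) : ∀ t ∈ Icc 0 T, φ t = ψ t := by
  have hφc : ContinuousOn φ (Icc 0 T) := fun t ht => (hφ t ht).continuousWithinAt
  have hψc : ContinuousOn ψ (Icc 0 T) := fun t ht => (hψ t ht).continuousWithinAt
  refine IsClosed.Icc_subset_of_forall_exists_gt (s := {t | φ t = ψ t}) ?_ h0 ?_
  · have : {t | φ t = ψ t} ∩ Icc 0 T = Icc 0 T ∩ (fun t => φ t - ψ t) ⁻¹' {0} := by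
      ext t; simp [sub_eq_zero, and_comm]
    rw [this]
    exact (hφc.sub hψc).preimage_isClosed_of_isClosed isClosed_Icc isClosed_singleton
  · rintro t ⟨hteq, ht⟩ s hs
    have ht' := Ico_subset_Icc_self ht
    obtain ⟨L, V, hV, hL⟩ := ((hf.contDiffAt (hU.mem_nhds (hψU t ht'))).of_le
      (m := 1) (by norm_cast)).exists_lipschitzOnWith
    have hI : Icc 0 T ∈ 𝓝[≥] t := Icc_mem_nhdsGE_of_mem ht
    have h1 : ∀ᶠ u in 𝓝[≥] t, φ u ∈ V :=
      ((hφc t ht').mono_of_mem_nhdsWithin hI).eventually (by rw [hteq]; exact hV)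
    have h2 : ∀ᶠ u in 𝓝[≥] t, ψ u ∈ V :=
      ((hψc t ht').mono_of_mem_nhdsWithin hI).eventually hV
    obtain ⟨u, hu, hsub⟩ := (mem_nhdsGE_iff_exists_mem_Ioc_Ico_subset hs).1
      ((h1.and h2).and hI)
    obtain ⟨w, htw, hwu⟩ := exists_between hu.1
    have hsub' : ∀ r ∈ Icc t w, (φ r ∈ V ∧ ψ r ∈ V) ∧ r ∈ Icc 0 T := fun r hr =>
      hsub ⟨hr.1, hr.2.trans_lt hwu⟩
    have hnhds : ∀ r ∈ Ico t w, Icc 0 T ∈ 𝓝[≥] r := fun r hr =>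
      Icc_mem_nhdsGE_of_mem ⟨(hsub' r (Ico_subset_Icc_self hr)).2.1,
        hr.2.trans_le (hsub' w (right_mem_Icc.2 htw.le)).2.2⟩
    have := dist_le_of_trajectories_ODE_of_mem (v := fun _ => f) (s := fun _ => V) (K := L)
      (f := φ) (g := ψ) (a := t) (b := w) (δ := 0) (fun _ _ => hL)
      (hφc.mono fun r hr => (hsub' r hr).2)
      (fun r hr => (hφ r (hsub' r (Ico_subset_Icc_self hr)).2).mono_of_mem_nhdsWithin (hnhds r hr))
      (fun r hr => (hsub' r (Ico_subset_Icc_self hr)).1.1)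
      (hψc.mono fun r hr => (hsub' r hr).2)
      (fun r hr => (hψ r (hsub' r (Ico_subset_Icc_self hr)).2).mono_of_mem_nhdsWithin (hnhds r hr))
      (fun r hr => (hsub' r (Ico_subset_Icc_self hr)).1.2)
      (by rw [show φ t = ψ t from hteq, dist_self]) w (right_mem_Icc.2 htw.le)
    refine ⟨w, ?_, htw, (hwu.trans_le hu.2).le⟩
    rw [zero_mul] at this
    exact dist_le_zero.1 this

/-- A phase is determined by its initial state, so it runs in `K` as soon as `K` contains one phase
with the same initial state. -/
theorem IsPhase.isPhaseIn {f : State n → State n} {S U K : Set (State n)} (hU : IsOpen U)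
    (hKU : K ⊆ U) (hf : ContDiffOn ℝ ∞ f U) {T T' : ℝ} {φ ψ : ℝ → State n}
    (hφ : IsPhase f S T φ) (hψ : IsPhaseIn f S K T' ψ) (h0 : φ 0 = ψ 0) :
    IsPhaseIn f S K T φ := by
  have hm : 0 ≤ min T T' := le_min hφ.nonneg hψ.nonneg
  have hl : Icc 0 (min T T') ⊆ Icc 0 T := Icc_subset_Icc_right (min_le_left _ _)
  have hr : Icc 0 (min T T') ⊆ Icc 0 T' := Icc_subset_Icc_right (min_le_right _ _)
  have heq := eqOn_Icc_of_flow hU hf (fun t ht => (hφ.flow t (hl ht)).mono hl)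
    (fun t ht => (hψ.flow t (hr ht)).mono hr) (fun t ht => hKU (hψ.mem t (hr ht))) h0
  have hTT : T = T' := by
    rcases lt_trichotomy T T' with h | h | h
    · refine absurd hφ.hit ?_
      rw [heq T ⟨hφ.nonneg, by simp [h.le]⟩]
      exact hψ.off T ⟨hφ.nonneg, h⟩
    · exact h
    · refine absurd hψ.hit ?_
      rw [← heq T' ⟨hψ.nonneg, by simp [h.le]⟩]
      exact hφ.off T' ⟨hψ.nonneg, h⟩
  subst hTT
  rw [min_self] at heq
  exact ⟨hφ, fun t ht => heq t ht ▸ hψ.mem t ht⟩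

section

variable {f g : State n → State n} {M : State n → State n →L[ℝ] State n} {S K : Set (State n)}
  {C T T' : ℝ} {φ ψ : ℝ → State n}

theorem IsPhaseIn.zero_mem (hφ : IsPhaseIn f S K T φ) : φ 0 ∈ K :=
  hφ.mem 0 (left_mem_Icc.2 hφ.nonneg)

theorem IsPhaseIn.end_mem (hφ : IsPhaseIn f S K T φ) : φ T ∈ K :=
  hφ.mem T (right_mem_Icc.2 hφ.nonneg)

theorem IsPhaseIn.continuousOn (hφ : IsPhaseIn f S K T φ) : ContinuousOn φ (Icc 0 T) :=
  fun t ht => (hφ.flow t ht).continuousWithinAt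

theorem IsPhaseIn.hasDerivAt (hφ : IsPhaseIn f S K T φ) {t : ℝ} (ht : t ∈ Ioo 0 T) :
    HasDerivAt φ (f (φ t)) t :=
  (hφ.flow t (Ioo_subset_Icc_self ht)).hasDerivAt (Icc_mem_nhds ht.1 ht.2)

theorem IsPhaseIn.norm_sub_le (hC : IsTubeBound f g M K C) (hφ : IsPhaseIn f S K T φ) {s t : ℝ}
    (hs : s ∈ Icc 0 T) (ht : t ∈ Icc 0 T) : ‖φ t - φ s‖ ≤ C * |t - s| :=
  (convex_Icc 0 T).norm_image_sub_le_of_norm_hasDerivWithin_le hφ.flow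
    (fun u hu => hC.speed _ (hφ.mem u hu)) hs ht

/-- The rest of a phase from the time `s` on. -/
theorem IsPhaseIn.shift (hφ : IsPhaseIn f S K T φ) {s : ℝ} (hs : s ∈ Icc 0 T) :
    IsPhaseIn f S K (T - s) (fun t => φ (s + t)) where
  nonneg := sub_nonneg.2 hs.2
  flow t ht := by
    have h1 : HasDerivWithinAt (fun t => s + t) 1 (Icc 0 (T - s)) t :=
      (hasDerivWithinAt_id t _).const_add s
    have h2 := (hφ.flow (s + t) ⟨by linarith [hs.1, ht.1], by linarith [ht.2]⟩).scomp t h1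
      (fun u hu => ⟨by linarith [hs.1, hu.1], by linarith [hu.2]⟩)
    rw [one_smul] at h2
    exact h2
  off t ht := hφ.off _ ⟨by linarith [hs.1, ht.1], by linarith [ht.2]⟩
  hit := by simpa using hφ.hit
  mem t ht := hφ.mem _ ⟨by linarith [hs.1, ht.1], by linarith [ht.2]⟩

theorem IsPhaseIn.norm_sub_le_exp (hC : IsTubeBound f g M K C) (hφ : IsPhaseIn f S K T φ)
    (hψ : IsPhaseIn f S K T' ψ) {t : ℝ} (h0 : 0 ≤ t) (ht : t ≤ T) (ht' : t ≤ T') :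
    ‖ψ t - φ t‖ ≤ ‖ψ 0 - φ 0‖ * Real.exp (C * t) := by
  have hl : Icc 0 t ⊆ Icc 0 T := Icc_subset_Icc_right ht
  have hr : Icc 0 t ⊆ Icc 0 T' := Icc_subset_Icc_right ht'
  have := norm_le_gronwallBound_of_norm_deriv_right_le (f := fun s => ψ s - φ s)
    (f' := fun s => f (ψ s) - f (φ s)) (δ := ‖ψ 0 - φ 0‖) (K := C) (ε := 0) (a := 0) (b := t)
    ((hψ.continuousOn.mono hr).sub (hφ.continuousOn.mono hl))
    (fun s hs => ((hψ.flow s (hr (Ico_subset_Icc_self hs))).mono_of_mem_nhdsWithin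
        (Icc_mem_nhdsGE_of_mem ⟨hs.1, hs.2.trans_le ht'⟩)).sub
      ((hφ.flow s (hl (Ico_subset_Icc_self hs))).mono_of_mem_nhdsWithin
        (Icc_mem_nhdsGE_of_mem ⟨hs.1, hs.2.trans_le ht⟩))) le_rfl
    (fun s hs => by
      rw [add_zero]
      exact hC.lip_f _ (hφ.mem s (hl (Ico_subset_Icc_self hs))) _
        (hψ.mem s (hr (Ico_subset_Icc_self hs)))) t (right_mem_Icc.2 h0)
  rwa [gronwallBound_ε0, sub_zero] at this

end

/-! ### Arrival times -/

section

variable {f g : State n → State n} {M : State n → State n →L[ℝ] State n} {U K : Set (State n)}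
  {z : State n} {b C : ℝ}

theorem isClosed_switchingSurface (z : State n) (b : ℝ) : IsClosed (switchingSurface z b) :=
  isClosed_eq (by fun_prop) continuous_const

/-- Close to the surface, the time that is left until the arrival is at most proportional to the
distance from the surface: `K` lies on the side from which the flow arrives, and the flow
approaches the surface with a speed bounded from below. -/
theorem exists_arrival_bound (hC : IsTubeBound f g M K C) (hK : IsCompact K) (hKU : K ⊆ U)
    (hf : ContinuousOn f U)
    (hfz : ∀ x ∈ K ∩ switchingSurface z b, ⟪z, f x⟫_ℝ ≠ 0)
    (hside : ∀ x ∈ K ∩ switchingSurface z b,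
      ∀ᶠ y in 𝓝[K] x, (⟪z, y⟫_ℝ - b) * ⟪z, f x⟫_ℝ ≤ 0) :
    ∃ ρ > 0, ∃ A, 0 ≤ A ∧ ∀ x ∈ K ∩ switchingSurface z b, ∀ T φ,
      IsPhaseIn f (switchingSurface z b) K T φ → ‖φ 0 - x‖ < ρ → T ≤ A * ‖φ 0 - x‖ := by
  have hC0 : 0 < C := zero_lt_one.trans_le hC.one_le
  refine (hK.inter_right (isClosed_switchingSurface z b)).induction_on
    (p := fun s => ∃ ρ > 0, ∃ A, 0 ≤ A ∧ ∀ x ∈ s, x ∈ K ∩ switchingSurface z b → ∀ T φ,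
      IsPhaseIn f (switchingSurface z b) K T φ → ‖φ 0 - x‖ < ρ → T ≤ A * ‖φ 0 - x‖)
    ⟨1, one_pos, 0, le_rfl, by simp⟩ ?_ ?_ ?_ |> fun ⟨ρ, hρ, A, hA, H⟩ =>
      ⟨ρ, hρ, A, hA, fun x hx => H x hx hx⟩
  · rintro s t hst ⟨ρ, hρ, A, hA, H⟩
    exact ⟨ρ, hρ, A, hA, fun x hx => H x (hst hx)⟩
  · rintro s t ⟨ρ, hρ, A, hA, H⟩ ⟨ρ', hρ', A', hA', H'⟩
    refine ⟨min ρ ρ', lt_min hρ hρ', max A A', le_max_of_le_left hA, ?_⟩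
    rintro x (hx | hx) hxS T φ hφ hd
    · exact (H x hx hxS T φ hφ (hd.trans_le (min_le_left _ _))).trans
        (by gcongr; exact le_max_left _ _)
    · exact (H' x hx hxS T φ hφ (hd.trans_le (min_le_right _ _))).trans
        (by gcongr; exact le_max_right _ _)
  · intro x₀ hx₀
    -- `w` is the normal of the surface, rescaled to point along the flow at `x₀`
    set w : State n := ⟪z, f x₀⟫_ℝ • z with hw
    have hwx : 0 < ⟪w, f x₀⟫_ℝ := by
      rw [hw, inner_smul_left, conj_trivial]
      exact mul_self_pos.2 (hfz x₀ hx₀)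
    obtain ⟨v, hv, hvx⟩ := exists_between hwx
    have hev : ∀ᶠ y in 𝓝[K] x₀, v < ⟪w, f y⟫_ℝ :=
      (continuousWithinAt_const.inner ((hf.mono hKU) x₀ hx₀.1)).eventually_const_lt hvx
    obtain ⟨ρ, hρ, hball⟩ := Metric.mem_nhdsWithin_iff.1 (hev.and (hside x₀ hx₀))
    set A := ‖w‖ / v with hA
    have hA0 : 0 ≤ A := by positivity
    -- within the time `τ`, a flow line that starts within `ρ / 2` of `x₀` stays within `ρ`
    set τ := ρ / (2 * C) with hτ
    have hτ0 : 0 < τ := by positivity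
    set σ := min (ρ / 4) (τ / (A + 1)) with hσ
    have hσ0 : 0 < σ := by positivity
    refine ⟨Metric.ball x₀ (ρ / 4), mem_nhdsWithin_of_mem_nhds
      (Metric.ball_mem_nhds _ (by positivity)), σ, hσ0, A, hA0, ?_⟩
    intro x hxb hxS T φ hφ hd
    have hstart : ‖φ 0 - x₀‖ < ρ / 2 := by
      have h1 : ‖x - x₀‖ < ρ / 4 := by simpa [dist_eq_norm] using hxb
      have h2 : ‖φ 0 - x‖ < ρ / 4 := hd.trans_le (min_le_left _ _)
      have h3 := norm_add_le (φ 0 - x) (x - x₀)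
      rw [sub_add_sub_cancel] at h3
      linarith
    have hAd : A * ‖φ 0 - x‖ < τ := by
      have h2 : ‖φ 0 - x‖ < τ / (A + 1) := hd.trans_le (min_le_right _ _)
      rw [lt_div_iff₀ (by positivity)] at h2
      nlinarith [norm_nonneg (φ 0 - x)]
    have hmT : Icc 0 (min T τ) ⊆ Icc 0 T := Icc_subset_Icc_right (min_le_left _ _)
    have hin : ∀ t ∈ Icc 0 (min T τ), v < ⟪w, f (φ t)⟫_ℝ ∧
        (⟪z, φ t⟫_ℝ - b) * ⟪z, f x₀⟫_ℝ ≤ 0 := by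
      intro t ht
      refine hball ⟨?_, hφ.mem t (hmT ht)⟩
      have h1 := hφ.norm_sub_le hC (left_mem_Icc.2 hφ.nonneg) (hmT ht)
      rw [sub_zero, abs_of_nonneg ht.1] at h1
      have h2 : C * t ≤ ρ / 2 := by
        calc C * t ≤ C * τ := by gcongr; exact ht.2.trans (min_le_right _ _)
          _ = ρ / 2 := by rw [hτ]; field_simp
      have h3 := norm_add_le (φ t - φ 0) (φ 0 - x₀)
      rw [sub_add_sub_cancel] at h3
      rw [Metric.mem_ball, dist_eq_norm]
      linarith
    have hm0 : 0 ≤ min T τ := le_min hφ.nonneg hτ0.le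
    have hgrow : v * (min T τ - 0) ≤ ⟪w, φ (min T τ)⟫_ℝ - ⟪w, φ 0⟫_ℝ := by
      have hderiv : ∀ t ∈ Ioo 0 (min T τ),
          HasDerivAt (fun s => ⟪w, φ s⟫_ℝ) ⟪w, f (φ t)⟫_ℝ t := fun t ht =>
        ((innerSL ℝ w).hasFDerivAt.comp_hasDerivAt t
          (hφ.hasDerivAt ⟨ht.1, ht.2.trans_le (min_le_left _ _)⟩))
      refine (convex_Icc 0 (min T τ)).mul_sub_le_image_sub_of_le_deriv
        (continuousOn_const.inner (hφ.continuousOn.mono hmT)) ?_ ?_ 0 (left_mem_Icc.2 hm0) _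
        (right_mem_Icc.2 hm0) hm0
      · rw [interior_Icc]
        exact fun t ht => (hderiv t ht).differentiableAt.differentiableWithinAt
      · rw [interior_Icc]
        intro t ht
        rw [(hderiv t ht).deriv]
        exact (hin t (Ioo_subset_Icc_self ht)).1.le
    have hend : ⟪w, φ (min T τ)⟫_ℝ ≤ ⟪w, x⟫_ℝ := by
      have h1 := (hin _ (right_mem_Icc.2 hm0)).2
      have h2 : ⟪z, x⟫_ℝ - b = 0 := hxS.2
      have hb : b = ⟪z, x⟫_ℝ := by linarith
      rw [hb] at h1
      simp only [hw, inner_smul_left, conj_trivial]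
      linarith
    have hmA : min T τ ≤ A * ‖φ 0 - x‖ := by
      have h1 : ⟪w, x - φ 0⟫_ℝ ≤ ‖w‖ * ‖φ 0 - x‖ := by
        rw [norm_sub_rev]; exact real_inner_le_norm _ _
      rw [inner_sub_right] at h1
      rw [hA, div_mul_eq_mul_div, le_div_iff₀ hv]
      linarith
    rcases min_choice T τ with h | h
    · rwa [h] at hmA
    · rw [h] at hmA; linarith

theorem exists_duration_bound (hC : IsTubeBound f g M K C) (hK : IsCompact K) (hKU : K ⊆ U)
    (hf : ContinuousOn f U)
    (hfz : ∀ x ∈ K ∩ switchingSurface z b, ⟪z, f x⟫_ℝ ≠ 0)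
    (hside : ∀ x ∈ K ∩ switchingSurface z b,
      ∀ᶠ y in 𝓝[K] x, (⟪z, y⟫_ℝ - b) * ⟪z, f x⟫_ℝ ≤ 0)
    (hreach : ∀ x ∈ K, ∃ T φ, IsPhaseIn f (switchingSurface z b) K T φ ∧ φ 0 = x) :
    ∃ B, ∀ T φ, IsPhaseIn f (switchingSurface z b) K T φ → T ≤ B := by
  obtain ⟨ρ, hρ, A, hA, H⟩ := exists_arrival_bound hC hK hKU hf hfz hside
  refine hK.induction_on (p := fun s => ∃ B, ∀ T φ,
    IsPhaseIn f (switchingSurface z b) K T φ → φ 0 ∈ s → T ≤ B)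
    ⟨0, by simp⟩ ?_ ?_ ?_ |> fun ⟨B, hB⟩ => ⟨B, fun T φ hφ => hB T φ hφ hφ.zero_mem⟩
  · rintro s t hst ⟨B, hB⟩
    exact ⟨B, fun T φ hφ h => hB T φ hφ (hst h)⟩
  · rintro s t ⟨B, hB⟩ ⟨B', hB'⟩
    refine ⟨max B B', ?_⟩
    rintro T φ hφ (h | h)
    · exact (hB T φ hφ h).trans (le_max_left _ _)
    · exact (hB' T φ hφ h).trans (le_max_right _ _)
  · intro x₀ hx₀
    obtain ⟨T₀, φ₀, hφ₀, rfl⟩ := hreach x₀ hx₀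
    refine ⟨Metric.ball (φ₀ 0) (ρ / Real.exp (C * T₀)), mem_nhdsWithin_of_mem_nhds
      (Metric.ball_mem_nhds _ (by positivity)), T₀ + A * ρ, fun T φ hφ h => ?_⟩
    rcases le_total T T₀ with hle | hle
    · have : 0 ≤ A * ρ := by positivity
      linarith
    · have h1 := hφ₀.norm_sub_le_exp hC hφ hφ₀.nonneg le_rfl hle
      rw [Metric.mem_ball, dist_eq_norm, lt_div_iff₀ (Real.exp_pos _)] at h
      have h2 : ‖φ T₀ - φ₀ T₀‖ < ρ := h1.trans_lt h
      have h3 := H _ ⟨hφ₀.end_mem, hφ₀.hit⟩ _ _ (hφ.shift ⟨hφ₀.nonneg, hle⟩) (by simpa using h2)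
      have h4 : A * ‖φ T₀ - φ₀ T₀‖ ≤ A * ρ := by gcongr
      simp only [add_zero] at h3
      linarith

/-- Over a whole phase, the flow is Lipschitz in the initial state, and so is the arrival time. -/
theorem exists_phase_bound (hC : IsTubeBound f g M K C) (hK : IsCompact K) (hKU : K ⊆ U)
    (hf : ContinuousOn f U)
    (hfz : ∀ x ∈ K ∩ switchingSurface z b, ⟪z, f x⟫_ℝ ≠ 0)
    (hside : ∀ x ∈ K ∩ switchingSurface z b,
      ∀ᶠ y in 𝓝[K] x, (⟪z, y⟫_ℝ - b) * ⟪z, f x⟫_ℝ ≤ 0)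
    (hreach : ∀ x ∈ K, ∃ T φ, IsPhaseIn f (switchingSurface z b) K T φ ∧ φ 0 = x) :
    ∃ ρ > 0, ∃ A, 1 ≤ A ∧ ∀ T T' φ ψ, IsPhaseIn f (switchingSurface z b) K T φ →
      IsPhaseIn f (switchingSurface z b) K T' ψ → T ≤ T' → ‖ψ 0 - φ 0‖ < ρ →
      T' - T ≤ A * ‖ψ 0 - φ 0‖ ∧ ∀ t ∈ Icc 0 T, ‖ψ t - φ t‖ ≤ A * ‖ψ 0 - φ 0‖ := by
  obtain ⟨ρ, hρ, A, hA, H⟩ := exists_arrival_bound hC hK hKU hf hfz hside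
  obtain ⟨B, hB⟩ := exists_duration_bound hC hK hKU hf hfz hside hreach
  have hC0 : 0 ≤ C := zero_le_one.trans hC.one_le
  set G := Real.exp (C * max B 0) with hG
  have hG1 : 1 ≤ G := Real.one_le_exp (by positivity)
  refine ⟨ρ / G, by positivity, G * (1 + A), by nlinarith, fun T T' φ ψ hφ hψ hle hd => ?_⟩
  have hflow : ∀ t ∈ Icc 0 T, ‖ψ t - φ t‖ ≤ G * ‖ψ 0 - φ 0‖ := fun t ht => by
    refine (hφ.norm_sub_le_exp hC hψ ht.1 ht.2 (ht.2.trans hle)).trans ?_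
    rw [mul_comm, hG]
    gcongr
    exact (ht.2.trans (hB T φ hφ)).trans (le_max_left _ _)
  have hend := hflow T (right_mem_Icc.2 hφ.nonneg)
  rw [lt_div_iff₀ (by positivity), mul_comm] at hd
  have h3 := H _ ⟨hφ.end_mem, hφ.hit⟩ _ _ (hψ.shift ⟨hφ.nonneg, hle⟩)
    (by simpa using hend.trans_lt hd)
  simp only [add_zero] at h3
  have hGd : 0 ≤ G * ‖ψ 0 - φ 0‖ := by positivity
  have hAG : 0 ≤ A * (G * ‖ψ 0 - φ 0‖) := by positivity
  refine ⟨?_, fun t ht => ?_⟩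
  · calc T' - T ≤ A * ‖ψ T - φ T‖ := h3
      _ ≤ A * (G * ‖ψ 0 - φ 0‖) := by gcongr
      _ ≤ G * (1 + A) * ‖ψ 0 - φ 0‖ := by linarith
  · linarith [hflow t ht]

end

/-! ### Comparison of two solutions over a phase and a jump -/

/-- The squared length of the displacement from `x` to `y`, measured in the metric at `x`. -/
noncomputable def pairEnergy (M : State n → State n →L[ℝ] State n) (x y : State n) : ℝ :=
  ⟪y - x, M x (y - x)⟫_ℝ

section

variable {f g : State n → State n} {M : State n → State n →L[ℝ] State n} {U K : Set (State n)}
  {z : State n} {b C rate : ℝ}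

theorem pairEnergy_swap_le (hC : IsTubeBound f g M K C) {x y : State n} (hx : x ∈ K)
    (hy : y ∈ K) : pairEnergy M y x ≤ pairEnergy M x y + C * ‖y - x‖ ^ 3 := by
  have h1 : pairEnergy M y x = pairEnergy M x y + ⟪y - x, (M y - M x) (y - x)⟫_ℝ := by
    rw [pairEnergy, pairEnergy, ← neg_sub y x, map_neg, inner_neg_neg,
      sub_apply, inner_sub_right]
    ring
  have h2 : ‖(M y - M x) (y - x)‖ ≤ C * ‖y - x‖ * ‖y - x‖ :=
    (M y - M x).le_of_opNorm_le (hC.lip_M x hx y hy) _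
  rw [h1]
  gcongr
  calc _ ≤ ‖y - x‖ * ‖(M y - M x) (y - x)‖ := real_inner_le_norm _ _
    _ ≤ ‖y - x‖ * (C * ‖y - x‖ * ‖y - x‖) := by gcongr
    _ = C * ‖y - x‖ ^ 3 := by ring

theorem pairEnergy_le (hC : IsTubeBound f g M K C) {x : State n} (hx : x ∈ K) (y : State n) :
    pairEnergy M x y ≤ C * ‖y - x‖ ^ 2 :=
  (hC.inner_le hx _ _).trans_eq (by ring)

/-- The effect on the squared length of a small change `e` of the displacement `w`. -/
theorem IsTubeBound.inner_self_le (hC : IsTubeBound f g M K C) (hM : IsMetricOn M U)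
    (hKU : K ⊆ U) {x : State n} (hx : x ∈ K) (w e : State n) :
    ⟪w, M x w⟫_ℝ ≤ ⟪w - e, M x (w - e)⟫_ℝ + 2 * (C * ‖e‖ * ‖w‖) := by
  have h1 := hM.inner_nonneg (hKU hx) e
  have h2 := hC.inner_le hx e w
  have h3 : ⟪w, M x e⟫_ℝ = ⟪e, M x w⟫_ℝ := by rw [← hM.symm x (hKU hx), real_inner_comm]
  simp only [map_sub, inner_sub_left, inner_sub_right, h3]
  linarith

/-- The jump does not increase the energy of a pair of points of the surface, up to an error of
third order: the displacement of the two points is tangent to the flat surface, hence orthogonal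
to the flow. -/
theorem pairEnergy_jump_le (hC : IsTubeBound f g M K C) (hM : IsMetricOn M U) (hKU : K ⊆ U)
    (hjump : ∀ x ∈ K ∩ switchingSurface z b, g x ∈ K)
    (horth : ∀ x ∈ K ∩ switchingSurface z b,
      ∀ δ : State n, ⟪z, δ⟫_ℝ = 0 → ⟪f x, M x δ⟫_ℝ = 0)
    (hdisc : ∀ x ∈ K ∩ switchingSurface z b,
      ∀ δ : State n, ⟪δ, M x (f x)⟫_ℝ = 0 →
        ⟪fderiv ℝ g x δ, M (g x) (fderiv ℝ g x δ)⟫_ℝ - ⟪δ, M x δ⟫_ℝ ≤ 0)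
    {x y : State n} (hx : x ∈ K ∩ switchingSurface z b) (hy : y ∈ K ∩ switchingSurface z b) :
    pairEnergy M (g x) (g y) ≤ pairEnergy M x y + 2 * C ^ 3 * ‖y - x‖ ^ 3 := by
  have hC0 : 0 ≤ C := zero_le_one.trans hC.one_le
  have hzδ : ⟪z, y - x⟫_ℝ = 0 := by
    rw [inner_sub_right]
    linarith [show ⟪z, x⟫_ℝ - b = 0 from hx.2, show ⟪z, y⟫_ℝ - b = 0 from hy.2]
  have h1 := hdisc x hx (y - x) (by
    rw [real_inner_comm, hM.symm x (hKU hx.1)]; exact horth x hx _ hzδ)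
  have h2 := hC.inner_self_le hM hKU (hjump x hx) (g y - g x)
    (g y - g x - fderiv ℝ g x (y - x))
  rw [sub_sub_cancel] at h2
  have h3 : C * ‖g y - g x - fderiv ℝ g x (y - x)‖ * ‖g y - g x‖ ≤ C ^ 3 * ‖y - x‖ ^ 3 :=
    calc _ ≤ C * (C * ‖y - x‖ ^ 2) * (C * ‖y - x‖) := by
          gcongr
          · exact hC.lin_g x hx.1 y hy.1
          · exact hC.lip_g x hx.1 y hy.1
      _ = _ := by ring
  simp only [pairEnergy]
  linarith

/-- A pair of phases: from the pair of initial states to the pair of end points on the surface, the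
energy shrinks by the contraction factor of the phase that arrives first, up to an error of third
order. While the second phase still runs, for a time of order `‖ψ 0 - φ 0‖`, the displacement
changes by a multiple of `f (φ T)` and an error of second order; as the final displacement is
orthogonal to `f (φ T)`, its energy is at most the transverse energy at the first arrival, up to an
error of third order. -/
theorem pairEnergy_phase_le (hC : IsTubeBound f g M K C) (hU : IsOpen U) (hKU : K ⊆ U)
    (hf : ContDiffOn ℝ ∞ f U) (hM : IsMetricOn M U) (hf_ne : ∀ x ∈ K, f x ≠ 0)
    (hrate : 0 < rate) (hcontr : TransverseContractingOn f M K rate)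
    (horth : ∀ x ∈ K ∩ switchingSurface z b,
      ∀ δ : State n, ⟪z, δ⟫_ℝ = 0 → ⟪f x, M x δ⟫_ℝ = 0) {A : ℝ} (hA : 1 ≤ A) {T T' : ℝ}
    {φ ψ : ℝ → State n} (hφ : IsPhaseIn f (switchingSurface z b) K T φ)
    (hψ : IsPhaseIn f (switchingSurface z b) K T' ψ) (hle : T ≤ T') (hd1 : ‖ψ 0 - φ 0‖ ≤ 1)
    (hTT : T' - T ≤ A * ‖ψ 0 - φ 0‖) (hd : ∀ t ∈ Icc 0 T, ‖ψ t - φ t‖ ≤ A * ‖ψ 0 - φ 0‖) :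
    pairEnergy M (φ T) (ψ T') ≤ Real.exp (-(2 * rate) * T) * pairEnergy M (φ 0) (ψ 0)
      + (C ^ 3 / rate * A ^ 3
          + 2 * C * (C * (C + 1) * A ^ 2) * (C * A + C * (C + 1) * A ^ 2)) *
        ‖ψ 0 - φ 0‖ ^ 3 := by
  set d := ‖ψ 0 - φ 0‖ with hd_def
  have hd0 : 0 ≤ d := norm_nonneg _
  have hC0 : 0 ≤ C := zero_le_one.trans hC.one_le
  have hA0 : 0 ≤ A := zero_le_one.trans hA
  have hT : 0 ≤ T := hφ.nonneg
  have hTm : T ∈ Icc 0 T' := ⟨hT, hle⟩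
  have hsub : Icc 0 T ⊆ Icc 0 T' := Icc_subset_Icc_right hle
  have hdecay := transverseEnergy_decay hC hU hKU hf hM hf_ne hrate hcontr hT hφ.flow
    (fun t ht => (hψ.flow t (hsub ht)).mono hsub) hφ.mem (fun t ht => hψ.mem t (hsub ht)) hd
  have hstart : transverseEnergy f M (φ 0) (ψ 0 - φ 0) ≤ pairEnergy M (φ 0) (ψ 0) :=
    transverseEnergy_le_self hM (hKU hφ.zero_mem) (hf_ne _ hφ.zero_mem) _
  set x := φ T with hx_def
  have hxK : x ∈ K := hφ.end_mem
  set p := ψ T with hp_def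
  set y := ψ T' with hy_def
  have hpx : ‖p - x‖ ≤ A * d := hd T (right_mem_Icc.2 hT)
  set e := y - p - (T' - T) • f x with he_def
  have he : ‖e‖ ≤ C * (C + 1) * A ^ 2 * d ^ 2 := by
    have hrun := (convex_Icc T T').norm_image_sub_le_of_norm_hasDerivWithin_le
      (f := fun s => ψ s - s • f x) (f' := fun s => f (ψ s) - (1 : ℝ) • f x)
      (C := C * ((C + 1) * (A * d))) (x := T) (y := T')
      (fun s hs => ((hψ.flow s ⟨hT.trans hs.1, hs.2⟩).mono (Icc_subset_Icc_left hT)).sub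
        ((hasDerivWithinAt_id s _).smul_const (f x)))
      (fun s hs => by
        have hs' : s ∈ Icc 0 T' := ⟨hT.trans hs.1, hs.2⟩
        rw [one_smul]
        refine (hC.lip_f x hxK _ (hψ.mem s hs')).trans ?_
        gcongr
        have h1 := hψ.norm_sub_le hC hTm hs'
        rw [abs_of_nonneg (sub_nonneg.2 hs.1)] at h1
        have h2 : C * (s - T) ≤ C * (A * d) := by
          gcongr
          linarith [hs.2]
        have h3 := norm_add_le (ψ s - p) (p - x)
        rw [sub_add_sub_cancel] at h3
        linarith)
      (left_mem_Icc.2 hle) (right_mem_Icc.2 hle)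
    rw [Real.norm_of_nonneg (sub_nonneg.2 hle)] at hrun
    have heq : e = ψ T' - T' • f x - (ψ T - T • f x) := by
      rw [he_def, sub_smul]; abel
    rw [heq]
    calc _ ≤ C * ((C + 1) * (A * d)) * (T' - T) := hrun
      _ ≤ C * ((C + 1) * (A * d)) * (A * d) := by gcongr
      _ = _ := by ring
  -- `a` removes the flow component of `p - x` and the way of the second phase after time `T`
  set a := ⟪p - x, M x (f x)⟫_ℝ / ⟪f x, M x (f x)⟫_ℝ + (T' - T) with ha_def
  have hw : y - x - a • f x - e = transversePart f M x (p - x) := by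
    rw [he_def, ha_def, add_smul, transversePart]; abel
  have hland : pairEnergy M x y ≤ ⟪y - x - a • f x, M x (y - x - a • f x)⟫_ℝ := by
    have hzδ : ⟪z, y - x⟫_ℝ = 0 := by
      rw [inner_sub_right]
      linarith [show ⟪z, x⟫_ℝ - b = 0 from hφ.hit, show ⟪z, y⟫_ℝ - b = 0 from hψ.hit]
    have h1 : ⟪f x, M x (y - x)⟫_ℝ = 0 := horth x ⟨hxK, hφ.hit⟩ _ hzδ
    have h2 : ⟪y - x, M x (f x)⟫_ℝ = 0 := by
      rw [real_inner_comm, hM.symm x (hKU hxK), h1]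
    have h3 := mul_nonneg (mul_self_nonneg a) (hM.inner_nonneg (hKU hxK) (f x))
    simp only [pairEnergy, map_sub (M x) (y - x), map_smul, inner_sub_left (y - x),
      inner_sub_right _ (M x (y - x)), inner_smul_left, inner_smul_right, h1, h2, conj_trivial]
    linarith
  have hξ : ‖transversePart f M x (p - x)‖ ≤ C * A * d :=
    (hC.norm_transversePart_le hM hKU hxK (hf_ne x hxK) _).trans
      (by rw [mul_assoc]; gcongr)
  have hdd : d ^ 2 ≤ d := by nlinarith
  have hwn : ‖y - x - a • f x‖ ≤ (C * A + C * (C + 1) * A ^ 2) * d := by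
    have h1 := norm_add_le (y - x - a • f x - e) e
    rw [sub_add_cancel, hw] at h1
    have h2 : C * (C + 1) * A ^ 2 * d ^ 2 ≤ C * (C + 1) * A ^ 2 * d := by gcongr
    linarith
  have hquad := hC.inner_self_le hM hKU hxK (y - x - a • f x) e
  rw [hw] at hquad
  have herr : C * ‖e‖ * ‖y - x - a • f x‖
      ≤ C * (C * (C + 1) * A ^ 2) * (C * A + C * (C + 1) * A ^ 2) * d ^ 3 :=
    calc _ ≤ C * (C * (C + 1) * A ^ 2 * d ^ 2) * ((C * A + C * (C + 1) * A ^ 2) * d) := by gcongr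
      _ = _ := by ring
  have hexp := mul_le_mul_of_nonneg_left hstart (Real.exp_pos (-(2 * rate) * T)).le
  change ⟪transversePart f M x (p - x), M x (transversePart f M x (p - x))⟫_ℝ ≤ _ at hdecay
  rw [mul_pow] at hdecay
  linarith

/-- Two phases that start close to each other: they stay close under the linear change of time, and
their energy contracts up to an error of third order. -/
theorem exists_phase_estimate (hC : IsTubeBound f g M K C) (hU : IsOpen U) (hK : IsCompact K)
    (hKU : K ⊆ U) (hf : ContDiffOn ℝ ∞ f U) (hM : IsMetricOn M U) (hf_ne : ∀ x ∈ K, f x ≠ 0)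
    (hfz : ∀ x ∈ K ∩ switchingSurface z b, ⟪z, f x⟫_ℝ ≠ 0)
    (hside : ∀ x ∈ K ∩ switchingSurface z b,
      ∀ᶠ y in 𝓝[K] x, (⟪z, y⟫_ℝ - b) * ⟪z, f x⟫_ℝ ≤ 0)
    (hreach : ∀ x ∈ K, ∃ T φ, IsPhaseIn f (switchingSurface z b) K T φ ∧ φ 0 = x)
    (hrate : 0 < rate) (hcontr : TransverseContractingOn f M K rate)
    (horth : ∀ x ∈ K ∩ switchingSurface z b,
      ∀ δ : State n, ⟪z, δ⟫_ℝ = 0 → ⟪f x, M x δ⟫_ℝ = 0) :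
    ∃ ρ > 0, ∃ A, 1 ≤ A ∧ ∀ T T' φ ψ, IsPhaseIn f (switchingSurface z b) K T φ →
      IsPhaseIn f (switchingSurface z b) K T' ψ → ‖ψ 0 - φ 0‖ < ρ →
      (∀ s ∈ Icc (0 : ℝ) 1, ‖ψ (s * T') - φ (s * T)‖ ≤ A * ‖ψ 0 - φ 0‖) ∧
      pairEnergy M (φ T) (ψ T') ≤ Real.exp (-(2 * rate) * min T T') * pairEnergy M (φ 0) (ψ 0)
        + A * ‖ψ 0 - φ 0‖ ^ 3 := by
  obtain ⟨ρ, hρ, A, hA, H⟩ := exists_phase_bound hC hK hKU hf.continuousOn hfz hside hreach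
  have hC0 : 0 ≤ C := zero_le_one.trans hC.one_le
  have hA0 : 0 ≤ A := zero_le_one.trans hA
  set B := C ^ 3 / rate * A ^ 3
    + 2 * C * (C * (C + 1) * A ^ 2) * (C * A + C * (C + 1) * A ^ 2) with hB
  have hB0 : 0 ≤ B := by positivity
  have hordered : ∀ T T' φ ψ, IsPhaseIn f (switchingSurface z b) K T φ →
      IsPhaseIn f (switchingSurface z b) K T' ψ → T ≤ T' → ‖ψ 0 - φ 0‖ < min ρ 1 →
      (∀ s ∈ Icc (0 : ℝ) 1, ‖ψ (s * T') - φ (s * T)‖ ≤ (A * (C + 1)) * ‖ψ 0 - φ 0‖) ∧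
      pairEnergy M (φ T) (ψ T') ≤ Real.exp (-(2 * rate) * T) * pairEnergy M (φ 0) (ψ 0)
        + B * ‖ψ 0 - φ 0‖ ^ 3 := by
    intro T T' φ ψ hφ hψ hle hd
    obtain ⟨h1, h2⟩ := H T T' φ ψ hφ hψ hle (hd.trans_le (min_le_left _ _))
    refine ⟨fun s hs => ?_, pairEnergy_phase_le hC hU hKU hf hM hf_ne hrate hcontr horth hA hφ hψ
      hle (hd.le.trans (min_le_right _ _)) h1 h2⟩
    have hsT : s * T ∈ Icc 0 T := ⟨mul_nonneg hs.1 hφ.nonneg, mul_le_of_le_one_left hφ.nonneg hs.2⟩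
    have hsT' : s * T' ∈ Icc 0 T' :=
      ⟨mul_nonneg hs.1 hψ.nonneg, mul_le_of_le_one_left hψ.nonneg hs.2⟩
    have h3 := hψ.norm_sub_le hC (⟨hsT.1, hsT.2.trans hle⟩ : s * T ∈ Icc 0 T') hsT'
    have h4 : |s * T' - s * T| ≤ A * ‖ψ 0 - φ 0‖ := by
      rw [← mul_sub, abs_of_nonneg (mul_nonneg hs.1 (sub_nonneg.2 hle))]
      exact (mul_le_of_le_one_left (sub_nonneg.2 hle) hs.2).trans h1
    have h5 := norm_add_le (ψ (s * T') - ψ (s * T)) (ψ (s * T) - φ (s * T))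
    rw [sub_add_sub_cancel] at h5
    calc _ ≤ C * (A * ‖ψ 0 - φ 0‖) + A * ‖ψ 0 - φ 0‖ :=
          h5.trans (add_le_add (h3.trans (by gcongr)) (h2 _ hsT))
      _ = _ := by ring
  set G := A * (C + 1) with hG
  have hG1 : 1 ≤ G := by nlinarith [hC.one_le]
  have hG0 : 0 ≤ G := zero_le_one.trans hG1
  have hCG : 0 ≤ C * G ^ 3 := by positivity
  refine ⟨min ρ 1, lt_min hρ one_pos, G + B + C + C * G ^ 3, by linarith, ?_⟩
  intro T T' φ ψ hφ hψ hd
  have hd0 := norm_nonneg (ψ 0 - φ 0)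
  rcases le_total T T' with hle | hle
  · obtain ⟨h1, h2⟩ := hordered T T' φ ψ hφ hψ hle hd
    rw [min_eq_left hle]
    refine ⟨fun s hs => (h1 s hs).trans ?_, h2.trans ?_⟩
    · gcongr; linarith
    · gcongr; linarith
  · rw [norm_sub_rev] at hd
    obtain ⟨h1, h2⟩ := hordered T' T ψ φ hψ hφ hle hd
    rw [min_eq_right hle]
    rw [norm_sub_rev (φ 0)] at h1 h2
    refine ⟨fun s hs => ?_, ?_⟩
    · rw [norm_sub_rev]
      refine (h1 s hs).trans ?_
      gcongr
      linarith
    · have h3 := pairEnergy_swap_le hC hψ.end_mem hφ.end_mem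
      have h4 := pairEnergy_swap_le hC hφ.zero_mem hψ.zero_mem
      have h5 := h1 1 (right_mem_Icc.2 zero_le_one)
      rw [one_mul, one_mul] at h5
      have h6 : C * ‖φ T - ψ T'‖ ^ 3 ≤ C * (G * ‖ψ 0 - φ 0‖) ^ 3 := by gcongr
      rw [mul_pow] at h6
      have hE0 := (Real.exp_pos (-(2 * rate) * T')).le
      have hE1 : Real.exp (-(2 * rate) * T') ≤ 1 := Real.exp_le_one_iff.2 (by
        nlinarith [hψ.nonneg])
      have h7 := mul_le_mul_of_nonneg_left h4 hE0
      have h8 : Real.exp (-(2 * rate) * T') * (C * ‖ψ 0 - φ 0‖ ^ 3) ≤ C * ‖ψ 0 - φ 0‖ ^ 3 :=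
        mul_le_of_le_one_left (by positivity) hE1
      have h9 : 0 ≤ G * ‖ψ 0 - φ 0‖ ^ 3 := by positivity
      linarith

/-- Phases that begin after a jump have a least duration, because `g` maps the compact set
`K ∩ S` off `S`. -/
theorem exists_pos_le_duration (hC : IsTubeBound f g M K C) (hK : IsCompact K) (hKU : K ⊆ U)
    (hg : ContinuousOn g U)
    (hjump : ∀ x ∈ K ∩ switchingSurface z b, g x ∉ switchingSurface z b) :
    ∃ τ > 0, ∀ T φ, IsPhaseIn f (switchingSurface z b) K T φ →
      ∀ x ∈ K ∩ switchingSurface z b, φ 0 = g x → τ ≤ T := by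
  have hcont : ContinuousOn (fun x => |⟪z, g x⟫_ℝ - b|) (K ∩ switchingSurface z b) :=
    ((continuousOn_const.inner (hg.mono (inter_subset_left.trans hKU))).sub
      continuousOn_const).abs
  obtain ⟨m, hm, H⟩ := (hK.inter_right (isClosed_switchingSurface z b)).exists_forall_le' hcont
    (a := 0) fun x hx => abs_pos.2 (hjump x hx)
  have hC0 : 0 ≤ C := zero_le_one.trans hC.one_le
  refine ⟨m / (‖z‖ * C + 1), by positivity, fun T φ hφ x hx h0 => ?_⟩
  rw [div_le_iff₀ (by positivity)]
  have h1 := hφ.norm_sub_le hC (right_mem_Icc.2 hφ.nonneg) (left_mem_Icc.2 hφ.nonneg)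
  rw [zero_sub, abs_neg, abs_of_nonneg hφ.nonneg] at h1
  have h2 : ⟪z, φ T⟫_ℝ - b = 0 := hφ.hit
  have hT := hφ.nonneg
  calc m ≤ |⟪z, g x⟫_ℝ - b| := H x hx
    _ = |⟪z, φ 0 - φ T⟫_ℝ| := by rw [← h0, inner_sub_right]; congr 1; linarith
    _ ≤ ‖z‖ * ‖φ 0 - φ T‖ := abs_real_inner_le_norm _ _
    _ ≤ ‖z‖ * (C * T) := by gcongr
    _ ≤ T * (‖z‖ * C + 1) := by linarith

end

/-! ### Stability of the hybrid system -/

/-- If two phases are not shorter than `τ` and start close to each other, the following jump leads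
to a pair of states with at most the same energy: the contraction of the flow dominates the errors
of third order. -/
theorem exists_pairEnergy_antitone {f g : State n → State n}
    {M : State n → State n →L[ℝ] State n} {U K : Set (State n)} {z : State n} {b C rate ρ A τ : ℝ}
    (hC : IsTubeBound f g M K C) (hM : IsMetricOn M U) (hKU : K ⊆ U)
    (hrate : 0 < rate) (hρ : 0 < ρ) (hA : 1 ≤ A) (hτ : 0 < τ)
    (hphase : ∀ T T' φ ψ, IsPhaseIn f (switchingSurface z b) K T φ →
      IsPhaseIn f (switchingSurface z b) K T' ψ → ‖ψ 0 - φ 0‖ < ρ →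
      (∀ s ∈ Icc (0 : ℝ) 1, ‖ψ (s * T') - φ (s * T)‖ ≤ A * ‖ψ 0 - φ 0‖) ∧
      pairEnergy M (φ T) (ψ T') ≤ Real.exp (-(2 * rate) * min T T') * pairEnergy M (φ 0) (ψ 0)
        + A * ‖ψ 0 - φ 0‖ ^ 3)
    (hjump : ∀ x ∈ K ∩ switchingSurface z b, g x ∈ K)
    (horth : ∀ x ∈ K ∩ switchingSurface z b,
      ∀ δ : State n, ⟪z, δ⟫_ℝ = 0 → ⟪f x, M x δ⟫_ℝ = 0)
    (hdisc : ∀ x ∈ K ∩ switchingSurface z b,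
      ∀ δ : State n, ⟪δ, M x (f x)⟫_ℝ = 0 →
        ⟪fderiv ℝ g x δ, M (g x) (fderiv ℝ g x δ)⟫_ℝ - ⟪δ, M x δ⟫_ℝ ≤ 0) :
    ∃ σ > 0, ∀ T T' φ ψ, IsPhaseIn f (switchingSurface z b) K T φ →
      IsPhaseIn f (switchingSurface z b) K T' ψ → τ ≤ T → τ ≤ T' → ‖ψ 0 - φ 0‖ < σ →
      pairEnergy M (g (φ T)) (g (ψ T')) ≤ pairEnergy M (φ 0) (ψ 0) := by
  have hC0 : 0 ≤ C := zero_le_one.trans hC.one_le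
  have hA0 : 0 ≤ A := zero_le_one.trans hA
  set q := Real.exp (-(2 * rate) * τ) with hq
  have hq1 : q < 1 := Real.exp_lt_one_iff.2 (by nlinarith)
  set B := A + 2 * C ^ 3 * A ^ 3 with hB
  have hB0 : 0 ≤ B := by positivity
  have hBC : 0 < B * C + 1 := by positivity
  refine ⟨min ρ ((1 - q) / (B * C + 1)), lt_min hρ (div_pos (sub_pos.2 hq1) hBC), ?_⟩
  intro T T' φ ψ hφ hψ hT hT' hd
  obtain ⟨h1, h2⟩ := hphase T T' φ ψ hφ hψ (hd.trans_le (min_le_left _ _))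
  set d := ‖ψ 0 - φ 0‖ with hd_def
  have hd0 : 0 ≤ d := norm_nonneg _
  have hdq : d * (B * C + 1) < 1 - q :=
    (lt_div_iff₀ hBC).1 (hd.trans_le (min_le_right _ _))
  have hD : d ^ 2 ≤ C * pairEnergy M (φ 0) (ψ 0) := hC.norm_sq_le _ hφ.zero_mem _
  have hD0 : 0 ≤ pairEnergy M (φ 0) (ψ 0) := hM.inner_nonneg (hKU hφ.zero_mem) _
  have h3 := pairEnergy_jump_le hC hM hKU hjump horth hdisc
    (x := φ T) (y := ψ T') ⟨hφ.end_mem, hφ.hit⟩ ⟨hψ.end_mem, hψ.hit⟩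
  have h4 : ‖ψ T' - φ T‖ ≤ A * d := by simpa using h1 1 (right_mem_Icc.2 zero_le_one)
  have h5 : 2 * C ^ 3 * ‖ψ T' - φ T‖ ^ 3 ≤ 2 * C ^ 3 * (A * d) ^ 3 := by gcongr
  have h6 : Real.exp (-(2 * rate) * min T T') * pairEnergy M (φ 0) (ψ 0)
      ≤ q * pairEnergy M (φ 0) (ψ 0) := by
    refine mul_le_mul_of_nonneg_right (Real.exp_le_exp.2 ?_) hD0
    nlinarith [le_min hT hT']
  have h7 : B * d ^ 3 ≤ (1 - q) * pairEnergy M (φ 0) (ψ 0) :=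
    calc B * d ^ 3 = B * d * d ^ 2 := by ring
      _ ≤ B * d * (C * pairEnergy M (φ 0) (ψ 0)) := by gcongr
      _ = (d * (B * C)) * pairEnergy M (φ 0) (ψ 0) := by ring
      _ ≤ (1 - q) * pairEnergy M (φ 0) (ψ 0) := by gcongr; linarith
  have h8 : B * d ^ 3 = A * d ^ 3 + 2 * C ^ 3 * (A * d) ^ 3 := by rw [hB]; ring
  linarith

/-- A solution that starts in `K` runs in `K`. -/
theorem HybridSolution.isPhaseIn {f g : State n → State n} {S U K : Set (State n)}
    (hU : IsOpen U) (hKU : K ⊆ U) (hf : ContDiffOn ℝ ∞ f U)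
    (hreach : ∀ x ∈ K, ∃ T φ, IsPhaseIn f S K T φ ∧ φ 0 = x)
    (hjump : ∀ x ∈ K ∩ S, g x ∈ K) (X : HybridSolution f g S) (hX : X.init ∈ K) (j : ℕ) :
    IsPhaseIn f S K (X.dur j) (X.arc j) := by
  have step : ∀ j, X.arc j 0 ∈ K → IsPhaseIn f S K (X.dur j) (X.arc j) := fun j hj => by
    obtain ⟨T, φ, hφ, h0⟩ := hreach _ hj
    exact (X.phase j).isPhaseIn hU hKU hf hφ h0.symm
  induction j with
  | zero => exact step 0 hX
  | succ j ih => exact step _ (by rw [X.jump]; exact hjump _ ⟨ih.end_mem, ih.hit⟩)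

end HybridContraction

theorem theorem1 {n : ℕ}
    (U K : Set (EuclideanSpace ℝ (Fin n)))
    (f g : EuclideanSpace ℝ (Fin n) → EuclideanSpace ℝ (Fin n))
    (M : EuclideanSpace ℝ (Fin n) →
      EuclideanSpace ℝ (Fin n) →L[ℝ] EuclideanSpace ℝ (Fin n))
    (z : EuclideanSpace ℝ (Fin n)) (b rate : ℝ)
    -- the data: `f`, `g`, `M` are smooth near the compact set `K`
    (hU : IsOpen U) (hK : IsCompact K) (hKU : K ⊆ U)
    (hf : ContDiffOn ℝ ∞ f U) (hg : ContDiffOn ℝ ∞ g U)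
    (hM : HybridContraction.IsMetricOn M U)
    -- no equilibrium in `K`, and the flow is transversal to the switching surface
    (hf_ne : ∀ x ∈ K, f x ≠ 0)
    (hfz : ∀ x ∈ K ∩ HybridContraction.switchingSurface z b, ⟪z, f x⟫_ℝ ≠ 0)
    -- the tube `K` ends at the surface: near it, `K` is on the side from which the flow arrives
    (hside : ∀ x ∈ K ∩ HybridContraction.switchingSurface z b,
      ∀ᶠ y in 𝓝[K] x, (⟪z, y⟫_ℝ - b) * ⟪z, f x⟫_ℝ ≤ 0)
    -- forward invariance: from each point of `K` the flow reaches the surface inside `K`,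
    -- and the jump leads back into `K`, off the surface
    (hreach : ∀ x ∈ K, ∃ (T : ℝ) (φ : ℝ → EuclideanSpace ℝ (Fin n)),
      HybridContraction.IsPhase f (HybridContraction.switchingSurface z b) T φ ∧
        φ 0 = x ∧ ∀ t ∈ Icc 0 T, φ t ∈ K)
    (hjump : ∀ x ∈ K ∩ HybridContraction.switchingSurface z b,
      g x ∈ K ∧ g x ∉ HybridContraction.switchingSurface z b)
    -- first: the flow is transverse contracting
    (hrate : 0 < rate)
    (hcontr : HybridContraction.TransverseContractingOn f M K rate)
    -- secondly: the flow meets the switching surface `M`-orthogonally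
    (horth : ∀ x ∈ K ∩ HybridContraction.switchingSurface z b,
      ∀ δ : EuclideanSpace ℝ (Fin n), ⟪z, δ⟫_ℝ = 0 → ⟪f x, M x δ⟫_ℝ = 0)
    -- thirdly: the jump does not expand transverse displacements
    (hdisc : ∀ x ∈ K ∩ HybridContraction.switchingSurface z b,
      ∀ δ : EuclideanSpace ℝ (Fin n), ⟪δ, M x (f x)⟫_ℝ = 0 →
        ⟪fderiv ℝ g x δ, M (g x) (fderiv ℝ g x δ)⟫_ℝ - ⟪δ, M x δ⟫_ℝ ≤ 0) :
    -- solutions in `K` run through all times up to infinity, and they are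
    -- Zhukovski stable, uniformly over `K`
    (∀ X : HybridContraction.HybridSolution f g (HybridContraction.switchingSurface z b),
      X.init ∈ K → Tendsto (fun N : ℕ => ∑ j ∈ Finset.range N, X.dur j) atTop atTop) ∧
    ∀ ε > 0, ∃ r > 0,
      ∀ X Y : HybridContraction.HybridSolution f g (HybridContraction.switchingSurface z b),
        X.init ∈ K → Y.init ∈ K → dist X.init Y.init < r →
          HybridContraction.StaysCloseUpToTime X Y ε := by
  open HybridContraction in
  have hreach' : ∀ x ∈ K, ∃ T φ, IsPhaseIn f (switchingSurface z b) K T φ ∧ φ 0 = x :=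
    fun x hx => let ⟨T, φ, hφ, h0, hmem⟩ := hreach x hx; ⟨T, φ, ⟨hφ, hmem⟩, h0⟩
  have hjumpK : ∀ x ∈ K ∩ switchingSurface z b, g x ∈ K := fun x hx => (hjump x hx).1
  obtain ⟨C, hC⟩ := exists_isTubeBound hU hK hKU hf hg hM
  have hC1 := hC.one_le
  have hC0 : 0 < C := zero_lt_one.trans_le hC1
  obtain ⟨τ, hτ, hdur⟩ := exists_pos_le_duration hC hK hKU hg.continuousOn
    fun x hx => (hjump x hx).2
  have hphaseIn := fun X hX j => HybridSolution.isPhaseIn hU hKU hf hreach' hjumpK X hX j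
  have hdurX : ∀ X : HybridSolution f g (switchingSurface z b), X.init ∈ K →
      ∀ j, τ ≤ X.dur (j + 1) := fun X hX j =>
    hdur _ _ (hphaseIn X hX (j + 1)) (X.arc j (X.dur j))
      ⟨(hphaseIn X hX j).end_mem, (X.phase j).hit⟩ (X.jump j)
  refine ⟨fun X hX => ?_, fun ε hε => ?_⟩
  · have hsum : ∀ N : ℕ, (N : ℝ) * τ ≤ ∑ j ∈ Finset.range (N + 1), X.dur j := fun N => by
      rw [Finset.sum_range_succ']
      have h1 := Finset.card_nsmul_le_sum (Finset.range N) (fun j => X.dur (j + 1)) τ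
        fun j _ => hdurX X hX j
      rw [Finset.card_range, nsmul_eq_mul] at h1
      linarith [(X.phase 0).nonneg]
    exact (tendsto_add_atTop_iff_nat 1).1 (tendsto_atTop_mono hsum
      (tendsto_natCast_atTop_atTop.atTop_mul_const hτ))
  obtain ⟨ρ, hρ, A, hA, hphase⟩ := exists_phase_estimate hC hU hK hKU hf hM hf_ne hfz hside
    hreach' hrate hcontr horth
  obtain ⟨σ, hσ, hstep⟩ := exists_pairEnergy_antitone hC hM hKU hrate hρ hA hτ hphase hjumpK
    horth hdisc
  have hA0 : 0 < A := zero_lt_one.trans_le hA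
  -- `‖Y.arc j 0 - X.arc j 0‖ < μ` is enough for the phase number `j`
  set μ := min (min ρ σ) (ε / A) with hμ
  have hμ0 : 0 < μ := lt_min (lt_min hρ hσ) (div_pos hε hA0)
  -- the factor `C * A` bounds the first phase with its jump, another `C` bounds all the others
  refine ⟨μ / (C * (C * A)), by positivity, fun X Y hX hY hXY => ?_⟩
  have hPX := hphaseIn X hX
  have hPY := hphaseIn Y hY
  have h0 : ‖Y.arc 0 0 - X.arc 0 0‖ * (C * (C * A)) < μ := by
    rw [← lt_div_iff₀ (by positivity), ← dist_eq_norm, dist_comm]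
    exact hXY
  set d := ‖Y.arc 0 0 - X.arc 0 0‖ with hd_def
  have hd0 : 0 ≤ d := norm_nonneg _
  have hCA : 1 ≤ C * (C * A) := one_le_mul_of_one_le_of_one_le hC1
    (one_le_mul_of_one_le_of_one_le hC1 hA)
  have hdμ : d < μ := (le_mul_of_one_le_right hd0 hCA).trans_lt h0
  have h1 : ‖Y.arc 1 0 - X.arc 1 0‖ ≤ C * A * d := by
    have h2 := (hphase _ _ _ _ (hPX 0) (hPY 0)
      (hdμ.trans_le ((min_le_left _ _).trans (min_le_left _ _)))).1 1 (right_mem_Icc.2 zero_le_one)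
    rw [one_mul, one_mul] at h2
    rw [X.jump 0, Y.jump 0]
    calc _ ≤ C * ‖Y.arc 0 (Y.dur 0) - X.arc 0 (X.dur 0)‖ :=
          hC.lip_g _ (hPX 0).end_mem _ (hPY 0).end_mem
      _ ≤ C * (A * d) := by gcongr
      _ = C * A * d := by ring
  have hclose : ∀ j, pairEnergy M (X.arc (j + 1) 0) (Y.arc (j + 1) 0) ≤ C * (C * A * d) ^ 2 →
      ‖Y.arc (j + 1) 0 - X.arc (j + 1) 0‖ < μ := fun j hj => by
    have h2 := hC.norm_sq_le _ (hPX (j + 1)).zero_mem (Y.arc (j + 1) 0 - X.arc (j + 1) 0)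
    have h3 : ‖Y.arc (j + 1) 0 - X.arc (j + 1) 0‖ ^ 2 ≤ (d * (C * (C * A))) ^ 2 :=
      calc _ ≤ C * (C * (C * A * d) ^ 2) := h2.trans (by gcongr; exact hj)
        _ = _ := by ring
    exact (abs_le_of_sq_le_sq' h3 (by positivity)).2.trans_lt h0
  have henergy : ∀ j,
      pairEnergy M (X.arc (j + 1) 0) (Y.arc (j + 1) 0) ≤ C * (C * A * d) ^ 2 := fun j => by
    induction j with
    | zero =>
      refine (pairEnergy_le hC (hPX 1).zero_mem _).trans ?_
      rw [zero_add]
      gcongr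
    | succ j ih =>
      rw [X.jump (j + 1), Y.jump (j + 1)]
      exact (hstep _ _ _ _ (hPX (j + 1)) (hPY (j + 1)) (hdurX X hX j) (hdurX Y hY j)
        ((hclose j ih).trans_le ((min_le_left _ _).trans (min_le_right _ _)))).trans ih
  have hall : ∀ j, ‖Y.arc j 0 - X.arc j 0‖ < μ := fun j => by
    cases j with
    | zero => exact hdμ
    | succ j => exact hclose j (henergy j)
  refine ⟨fun _ => OrderIso.refl _, fun j s => ?_⟩
  have h2 := (hphase _ _ _ _ (hPX j) (hPY j)
    ((hall j).trans_le ((min_le_left _ _).trans (min_le_left _ _)))).1 s s.2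
  rw [dist_comm, dist_eq_norm]
  refine h2.trans_lt ?_
  have h3 := (hall j).trans_le (min_le_right (min ρ σ) (ε / A))
  rwa [lt_div_iff₀ hA0, mul_comm] at h3
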